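/- **Setting.** Let $c_1,\dots,c_N$ be operators on a nonzero finite-dimensional complex Hilbert space (for instance $(\mathbb C^2)^{\otimes N}$) satisfying the canonical anti-commutation relations $\{c_i,c_j\}=\{c_i^*,c_j^*\}=0$, $\{c_i,c_j^*\}=\delta_{ij}$. Let $\mathbf M=\mathbf M^*$ and $\mathbf\Delta=-\mathbf\Delta^\top$ be complex $N\times N$ matrices, $$H_{\mathrm{BdG}}=\tfrac12\sum_{i,j}\mathbf M_{ij}(c_i^*c_j-c_jc_i^*)+\tfrac12\sum_{i,j}\big(\mathbf\Delta_{ij}c_i^*c_j^*-\overline{\mathbf\Delta_{ij}}\,c_ic_j\big),\qquad \mathbf C=\begin{pmatrix}\mathbf 0&\mathbf I\\ \mathbf I&\mathbf 0\end{pmatrix}.$$ Let $\mathbf W$ be a unitary $2N\times2N$ matrix with $\mathbf W^\top\mathbf C\mathbf W=\mathbf C$ (a Bogoliubov matrix) and let $\epsilon_1,\dots,\epsilon_N$ be real numbers (the quasi-particle energies) such that $$\begin{pmatrix}-\overline{\mathbf M}&-\overline{\mathbf\Delta}\\ \mathbf\Delta&\mathbf M\end{pmatrix}=\mathbf W^*\begin{pmatrix}\mathrm{Diag}(-\epsilon_k)&\mathbf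 0\\ \mathbf 0&\mathrm{Diag}(\epsilon_k)\end{pmatrix}\mathbf W .$$ For a $2N\times 2N$ matrix $\mathbf S$ with $N\times N$ blocks $\mathbf S_{11},\mathbf S_{12},\mathbf S_{21},\mathbf S_{22}$ put $$\mathbb K_{\mathbf S}(i,j)=\begin{pmatrix}\mathbf S_{21}(i,j)&\mathbf S_{22}(i,j)\\ \mathbf S_{11}(i,j)-\delta_{ij}&\mathbf S_{12}(i,j)\end{pmatrix}.$$ For a kernel $\mathbb K$ with $\mathbb K(i,j)^\top=-\mathbb K(j,i)$, a random subset $Y\subseteq[N]$ satisfies $Y\sim\mathrm{PfPP}(\mathbb K)$ if $\mathbb P(T\subseteq Y)=\mathrm{Pf}\,[\mathbb K(i,j)]_{i,j\in T}$ for all $T\subseteq[N]$. For $\beta>0$ let $\rho_\beta=e^{-\beta H_{\mathrm{BdG}}}/\mathrm{tr}\,e^{-\beta H_{\mathrm{BdG}}}$, $\langle A\rangle=\mathrm{tr}(\rho_\beta A)$, and let $\mathbb K_\beta=\mathbb K_{\mathbf S}$ for $$\mathbf S=\begin{pmatrix}(\langle c_ic_j^*\rangle)_{i,j}&(\langle c_ic_j\rangle)_{i,j}\\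 (\langle c_i^*c_j^*\rangle)_{i,j}&(\langle c_i^*c_j\rangle)_{i,j}\end{pmatrix}.$$ For $\mathcal C\subseteq[N]$ let $\mathbf S(\mathcal C)=\overline{\mathbf W}^{*}\begin{pmatrix}\mathbf I_{\bar{\mathcal C}}&\mathbf 0\\ \mathbf 0&\mathbf I_{\mathcal C}\end{pmatrix}\overline{\mathbf W}$, where $\mathbf I_{\mathcal C}$ is the diagonal $0/1$ matrix supported on $\mathcal C$ and $\mathbf I_{\bar{\mathcal C}}=\mathbf I-\mathbf I_{\mathcal C}$. **Claims.** 1. For all $\beta>0$ and $Y\sim\mathrm{PfPP}(\mathbb K_\beta)$, $$\mathbb E(-1)^{|Y|}=\det(\mathbf W)\prod_{k=1}^N\tanh(\beta\epsilon_k/2).$$ 2. There is exactly one real skew-symmetric $2N\times2N$ matrix $\mathbf A_M$ with $H_{\mathrm{BdG}}=\frac{\mathrm i}{2}\gamma^\top\mathbf A_M\gamma$, where $\gamma_{2k-1}=\frac1{\sqrt2}(c_k^*+c_k)$ and $\gamma_{2k}=\frac{\mathrm i}{\sqrt2}(c_k^*-c_k)$. If all $\epsilon_k>0$, then $\det\mathbf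 W=\operatorname{sign}\mathrm{Pf}(\mathbf A_M)$, so that $\mathbb E(-1)^{|Y|}=\operatorname{sign}\mathrm{Pf}(\mathbf A_M)\prod_k\tanh(\beta\epsilon_k/2)$ for $Y\sim\mathrm{PfPP}(\mathbb K_\beta)$. 3. $\det\mathbf W\in\{-1,1\}$. For every $\mathcal C\subseteq[N]$, $\mathbf S(\mathcal C)$ is an orthogonal projection with $\mathbf C\overline{\mathbf S(\mathcal C)}\mathbf C=\mathbf I-\mathbf S(\mathcal C)$, and if $Y\sim\mathrm{PfPP}(\mathbb K_{\mathbf S(\mathcal C)})$, then $\mathbb E(-1)^{|Y|}=(-1)^{|\mathcal C|}\det\mathbf W$ and almost surely $(-1)^{|Y|}=(-1)^{|\mathcal C|}\det\mathbf W$. 4. (Zero-temperature limit.) Suppose that $\epsilon_k<0$ for $k\in\mathcal C$ and $\epsilon_k>0$ for $k\notin\mathcal C$. Then, for every $T\subseteq[N]$, $\mathrm{Pf}[\mathbb K_\beta(i,j)]_{i,j\in T}\to\mathrm{Pf}[\mathbb K_{\mathbf S(\mathcal C)}(i,j)]_{i,j\in T}$ as $\beta\to\infty$, and $(-1)^{|\mathcal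 C|}\det\mathbf W=\operatorname{sign}\mathrm{Pf}(\mathbf A_M)$. If $Y_\beta\sim\mathrm{PfPP}(\mathbb K_\beta)$ for all $\beta>0$, then $Y_\beta$ converges in law to some $Y_\infty\sim\mathrm{PfPP}(\mathbb K_{\mathbf S(\mathcal C)})$, $\mathbb E(-1)^{|Y_\beta|}\to\mathbb E(-1)^{|Y_\infty|}=\operatorname{sign}\mathrm{Pf}(\mathbf A_M)$, and almost surely $(-1)^{|Y_\infty|}=\operatorname{sign}\mathrm{Pf}(\mathbf A_M)$. In particular, if all $\epsilon_k>0$ (so $\mathcal C=\emptyset$), then the parity of $|Y_\infty|$ is almost surely $\operatorname{sign}\mathrm{Pf}(\mathbf A_M)=\det\mathbf W$ (Kitaev's formula). -/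

import Mathlib

open scoped Matrix

noncomputable section

/-- The Pfaffian `1 / (2 ^ n n!) * ∑ σ, sgn σ * A σ(1)σ(2) * ⋯ * A σ(2n-1)σ(2n)` of a square matrix
of size `2n`, `n = |κ|`, whose rows and columns are labelled by `κ × Fin 2`.
For `κ = Fin n` the labels `(i, 0)` and `(i, 1)` stand for the positions `2i - 1` and `2i`
(with `i` counted from `1`). No order on `κ` is needed: permuting the pairs is an even
permutation of the positions. -/
def pfaffian {κ F : Type*} [Fintype κ] [DecidableEq κ] [Field F]
    (A : Matrix (κ × Fin 2) (κ × Fin 2) F) : F :=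
  (2 ^ Fintype.card κ * (Nat.factorial (Fintype.card κ) : F))⁻¹ *
    ∑ σ : Equiv.Perm (κ × Fin 2),
      ((Equiv.Perm.sign σ : ℤ) : F) * ∏ i : κ, A (σ (i, 0)) (σ (i, 1))

/-- The `2|T| × 2|T|` matrix `[𝕂(i,j)]` with `i, j ∈ T`, made of `2 × 2` blocks. -/
def kernelMinor {N : ℕ} (K : Fin N → Fin N → Matrix (Fin 2) (Fin 2) ℂ) (T : Finset (Fin N)) :
    Matrix (T × Fin 2) (T × Fin 2) ℂ :=
  Matrix.of fun p q => K p.1 q.1 p.2 q.2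

/-- The correlation function `Pf (𝕂_T)` of a matrix-valued kernel. -/
def pfCorrelation {N : ℕ} (K : Fin N → Fin N → Matrix (Fin 2) (Fin 2) ℂ)
    (T : Finset (Fin N)) : ℂ :=
  pfaffian (kernelMinor K T)

/-- The point process `μ` (a probability measure on the subsets of `Fin N`) is the Pfaffian point
process `PfPP(𝕂)`: `𝕂` is a skew kernel, and `ℙ(T ⊆ Y) = Pf (𝕂_T)` for all `T`, if `Y ~ μ`. -/
def IsPfPP {N : ℕ} (K : Fin N → Fin N → Matrix (Fin 2) (Fin 2) ℂ)
    (μ : PMF (Finset (Fin N))) : Prop :=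
  (∀ i j, (K i j)ᵀ = -K j i) ∧
    ∀ T : Finset (Fin N), ((μ.toOuterMeasure {Y | T ⊆ Y}).toReal : ℂ) = pfCorrelation K T

/-- The expected parity `𝔼 (-1)^|Y|` for `Y ~ μ`. -/
def expectedParity {N : ℕ} (μ : PMF (Finset (Fin N))) : ℝ :=
  ∑ Y : Finset (Fin N), (μ Y).toReal * (-1) ^ Y.card

/-- The kernel `𝕂_S` of a `2N × 2N` matrix `S`. -/
def kernelOf {N : ℕ} (S : Matrix (Fin N ⊕ Fin N) (Fin N ⊕ Fin N) ℂ) (i j : Fin N) :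
    Matrix (Fin 2) (Fin 2) ℂ :=
  !![S.toBlocks₂₁ i j, S.toBlocks₂₂ i j;
     S.toBlocks₁₁ i j - (1 : Matrix (Fin N) (Fin N) ℂ) i j, S.toBlocks₁₂ i j]

/-- The block matrix `C = (0 I; I 0)`. -/
def swapBlocks (N : ℕ) : Matrix (Fin N ⊕ Fin N) (Fin N ⊕ Fin N) ℂ :=
  Matrix.fromBlocks 0 1 1 0

/-- The entrywise complex conjugate of a matrix. -/
def conjMat {m n : Type*} (A : Matrix m n ℂ) : Matrix m n ℂ :=
  A.map (starRingEnd ℂ)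

/-- The matrix `(-conj M, -conj Δ; Δ, M)` of the BdG Hamiltonian. -/
def bdgMatrix {N : ℕ} (M Δ : Matrix (Fin N) (Fin N) ℂ) :
    Matrix (Fin N ⊕ Fin N) (Fin N ⊕ Fin N) ℂ :=
  Matrix.fromBlocks (-conjMat M) (-conjMat Δ) Δ M

/-- `W` is a Bogoliubov matrix diagonalizing the BdG Hamiltonian, with quasi-particle energies
`ε`: `W` is a unitary orthogonal complex matrix, and the matrix of the Hamiltonian is
`W* diag(-ε, ε) W`. -/
structure IsBogoliubovDiag {N : ℕ} (M Δ : Matrix (Fin N) (Fin N) ℂ)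
    (W : Matrix (Fin N ⊕ Fin N) (Fin N ⊕ Fin N) ℂ) (ε : Fin N → ℝ) : Prop where
  orthogonal : Wᵀ * swapBlocks N * W = swapBlocks N
  unitary : W ∈ Matrix.unitaryGroup (Fin N ⊕ Fin N) ℂ
  diag : bdgMatrix M Δ =
    Wᴴ * Matrix.fromBlocks (Matrix.diagonal fun k => -(ε k : ℂ)) 0 0
      (Matrix.diagonal fun k => (ε k : ℂ)) * W

/-- The matrix `(conj W)* diag(I_{Cᶜ}, I_C) (conj W)`. -/
def projS {N : ℕ} (W : Matrix (Fin N ⊕ Fin N) (Fin N ⊕ Fin N) ℂ) (C : Finset (Fin N)) :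
    Matrix (Fin N ⊕ Fin N) (Fin N ⊕ Fin N) ℂ :=
  (conjMat W)ᴴ * Matrix.fromBlocks (Matrix.diagonal fun k => if k ∈ C then 0 else 1) 0 0
    (Matrix.diagonal fun k => if k ∈ C then 1 else 0) * conjMat W

section Operators

variable {N : ℕ} {𝓗 : Type*} [NormedAddCommGroup 𝓗] [InnerProductSpace ℂ 𝓗] [CompleteSpace 𝓗]

/-- The canonical anti-commutation relations; `star` is the Hilbert space adjoint. -/
structure IsCAR (c : Fin N → 𝓗 →L[ℂ] 𝓗) : Prop where
  anticomm : ∀ i j, c i * c j + c j * c i = 0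
  anticomm_star : ∀ i j, star (c i) * star (c j) + star (c j) * star (c i) = 0
  anticomm_mixed : ∀ i j, c i * star (c j) + star (c j) * c i = if i = j then 1 else 0

/-- The Bogoliubov-de Gennes Hamiltonian. -/
def bdgHamiltonian (c : Fin N → 𝓗 →L[ℂ] 𝓗) (M Δ : Matrix (Fin N) (Fin N) ℂ) : 𝓗 →L[ℂ] 𝓗 :=
  (1 / 2 : ℂ) • ∑ i, ∑ j, M i j • (star (c i) * c j - c j * star (c i)) +
    (1 / 2 : ℂ) • ∑ i, ∑ j,
      (Δ i j • (star (c i) * star (c j)) - starRingEnd ℂ (Δ i j) • (c i * c j))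

/-- The trace of an operator. -/
def opTrace (A : 𝓗 →L[ℂ] 𝓗) : ℂ :=
  LinearMap.trace ℂ 𝓗 (A : 𝓗 →ₗ[ℂ] 𝓗)

/-- The thermal state `exp (-β H) / tr exp (-β H)`. -/
def gibbsState (H : 𝓗 →L[ℂ] 𝓗) (β : ℝ) : 𝓗 →L[ℂ] 𝓗 :=
  (opTrace (NormedSpace.exp (-(β : ℂ) • H)))⁻¹ • NormedSpace.exp (-(β : ℂ) • H)

/-- The matrix of expectations `(⟨c_i c_j*⟩, ⟨c_i c_j⟩; ⟨c_i* c_j*⟩, ⟨c_i* c_j⟩)` of bilinears in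
the state `ρ`, where `⟨A⟩ = tr (ρ A)`. -/
def bilinearExpectations (c : Fin N → 𝓗 →L[ℂ] 𝓗) (ρ : 𝓗 →L[ℂ] 𝓗) :
    Matrix (Fin N ⊕ Fin N) (Fin N ⊕ Fin N) ℂ :=
  Matrix.fromBlocks
    (Matrix.of fun i j => opTrace (ρ * (c i * star (c j))))
    (Matrix.of fun i j => opTrace (ρ * (c i * c j)))
    (Matrix.of fun i j => opTrace (ρ * (star (c i) * star (c j))))
    (Matrix.of fun i j => opTrace (ρ * (star (c i) * c j)))

/-- The Pfaffian kernel of the thermal state of the BdG Hamiltonian at inverse temperature `β`. -/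
def thermalKernel (c : Fin N → 𝓗 →L[ℂ] 𝓗) (M Δ : Matrix (Fin N) (Fin N) ℂ) (β : ℝ) :
    Fin N → Fin N → Matrix (Fin 2) (Fin 2) ℂ :=
  kernelOf (bilinearExpectations c (gibbsState (bdgHamiltonian c M Δ) β))

/-- The Majorana operators `(c_k* + c_k) / √2`, at `(k, 0)`, and `i (c_k* - c_k) / √2`,
at `(k, 1)`. -/
def majorana (c : Fin N → 𝓗 →L[ℂ] 𝓗) (p : Fin N × Fin 2) : 𝓗 →L[ℂ] 𝓗 :=
  if p.2 = 0 then ((1 : ℂ) / (Real.sqrt 2 : ℂ)) • (star (c p.1) + c p.1)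
  else (Complex.I / (Real.sqrt 2 : ℂ)) • (star (c p.1) - c p.1)

/-- `A` is the real skew-symmetric quadratic form of the Majorana representation
`(i / 2) γᵀ A γ` of the BdG Hamiltonian. -/
def IsMajoranaForm (c : Fin N → 𝓗 →L[ℂ] 𝓗) (M Δ : Matrix (Fin N) (Fin N) ℂ)
    (A : Matrix (Fin N × Fin 2) (Fin N × Fin 2) ℝ) : Prop :=
  Aᵀ = -A ∧
    bdgHamiltonian c M Δ =
      (Complex.I / 2) • ∑ p, ∑ q, (A p q : ℂ) • (majorana c p * majorana c q)

end Operators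

end

open scoped Matrix

noncomputable section

/-! ### Pfaffians: congruence and expansion over principal minors. -/

section Pfaffian

variable {κ F : Type*} [Fintype κ] [DecidableEq κ] [Field F]

/-! Since `(-1)^|Y| = ∑_{T ⊆ Y} (-2)^|T|`, the expected parity is `∑_T (-2)^|T| Pf(𝕂_T)`. By the
Pfaffian analogue of `det (1 + A) = ∑ det A_T` (`pfaffian_add_pairForm_univ`) this sum is `Pf(J -
2𝕂)`, with `J` the standard symplectic form. In block labels `J - 2𝕂_S` is `C(1 - 2S)`. If `S = Wᵀ
diag(1 - f, f) conj W`, the relation `C Wᵀ = Wᴴ C` makes this a congruence by `conj W` of a direct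
sum of `2 × 2` skew blocks, so the parity is `det W ∏ (1 - 2 f_k)`
(`sum_pfCorrelation_of_isBogoliubov`).

For the thermal state, the rows of `conj W` give operators `x` with `[H, x] = ±ε_k x`. Cyclicity of
the trace (the KMS condition) and the anti-commutation relations then fix all two-point functions:
`f` is the Fermi function and `1 - 2f = tanh(βε/2)` (`bilinearExpectations_gibbsState`). For `S(𝒞)`,
`f` is the indicator of `𝒞`, the expected parity is a sign, and hence the parity is almost surely
constant.

The Majorana form is a congruence of the Hamiltonian's bilinear form, so the same Pfaffian
computation gives `Pf(A_M) = det W ∏ ε_k` (`pfaffian_realMajoranaForm`). Uniqueness of `A_M` comes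
from commutators in the Clifford algebra. As `β → ∞` the Fermi functions tend to the indicator of
the negative energies, and inclusion probabilities on a finite set determine the law, so the limit
process exists. -/

/-- The Pfaffian is multiplied by `det B` under the congruence `A ↦ Bᵀ A B`. -/
theorem pfaffian_congruence (A B : Matrix (κ × Fin 2) (κ × Fin 2) F) :
    pfaffian (Bᵀ * A * B) = B.det * pfaffian A := by
  have key : ∀ σ : Equiv.Perm (κ × Fin 2),
      ∏ i : κ, (Bᵀ * A * B) (σ (i, 0)) (σ (i, 1)) =
        ∑ f : κ × Fin 2 → κ × Fin 2, (∏ i : κ, A (f (i, 0)) (f (i, 1))) *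
          ∏ x, B (f x) (σ x) := by
    intro σ
    have h1 : ∀ i : κ, (Bᵀ * A * B) (σ (i, 0)) (σ (i, 1)) =
        ∑ g : Fin 2 → κ × Fin 2, A (g 0) (g 1) * ∏ j, B (g j) (σ (i, j)) := by
      intro i
      rw [← (finTwoArrowEquiv (κ × Fin 2)).symm.sum_comp, Fintype.sum_prod_type]
      simp only [Matrix.mul_apply, Matrix.transpose_apply, finTwoArrowEquiv_symm_apply,
        Fin.prod_univ_two, Matrix.cons_val_zero, Matrix.cons_val_one, Finset.sum_mul]
      rw [Finset.sum_comm]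
      refine Finset.sum_congr rfl fun p _ => Finset.sum_congr rfl fun q _ => ?_
      ring
    simp only [h1]
    rw [Finset.prod_univ_sum, Fintype.piFinset_univ,
      ← (Equiv.curry κ (Fin 2) (κ × Fin 2)).sum_comp]
    refine Finset.sum_congr rfl fun f _ => ?_
    rw [Finset.prod_mul_distrib, Fintype.prod_prod_type]
    rfl
  unfold pfaffian
  rw [mul_left_comm]
  congr 1
  simp only [key, Finset.mul_sum]
  rw [Finset.sum_comm]
  -- As for multiplicativity of `det`: after expanding over all maps `f`, the signed sum over `σ` is
  -- a determinant of rows of `B` selected by `f`, which vanishes unless `f` is a permutation.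
  have h2 : ∀ f : κ × Fin 2 → κ × Fin 2,
      ∑ σ : Equiv.Perm (κ × Fin 2), ((Equiv.Perm.sign σ : ℤ) : F) *
        ((∏ i : κ, A (f (i, 0)) (f (i, 1))) * ∏ x, B (f x) (σ x)) =
      (∏ i : κ, A (f (i, 0)) (f (i, 1))) * (B.submatrix f id).det := by
    intro f
    rw [← Matrix.det_transpose, Matrix.det_apply', Finset.mul_sum]
    refine Finset.sum_congr rfl fun σ _ => ?_
    simp only [Matrix.transpose_apply, Matrix.submatrix_apply, id]
    ring
  simp only [h2]
  symm
  refine Finset.sum_bij_ne_zero (fun (σ : Equiv.Perm (κ × Fin 2)) _ _ => ⇑σ)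
    (fun _ _ _ => Finset.mem_univ _) (fun _ _ _ _ _ _ h => Equiv.coe_fn_injective h) ?_ ?_
  · intro f _ hf
    have hinj : Function.Injective f := by
      by_contra hn
      obtain ⟨a, b, hab, hne⟩ := Function.not_injective_iff.1 hn
      apply hf
      rw [Matrix.det_zero_of_row_eq hne (by ext j; simp [hab]), mul_zero]
    have h3 := Finite.injective_iff_bijective.1 hinj
    refine ⟨Equiv.ofBijective f h3, Finset.mem_univ _, ?_, rfl⟩
    intro h0
    apply hf
    have h4 := Matrix.det_permute (Equiv.ofBijective f h3) B
    have h5 : (B.submatrix (Equiv.ofBijective f h3) id) = B.submatrix f id := rfl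
    rw [h5] at h4
    rw [h4, ← h0]
    simp only [Equiv.ofBijective_apply]
    ring
  · intro σ _ _
    rw [Matrix.det_permute]
    ring

theorem pfaffian_smul (a : F) (A : Matrix (κ × Fin 2) (κ × Fin 2) F) :
    pfaffian (a • A) = a ^ Fintype.card κ * pfaffian A := by
  unfold pfaffian
  rw [mul_left_comm]
  congr 1
  rw [Finset.mul_sum]
  refine Finset.sum_congr rfl fun σ _ => ?_
  simp only [Matrix.smul_apply, smul_eq_mul, Finset.prod_mul_distrib, Finset.prod_const,
    Finset.card_univ]
  ring

theorem pfaffian_map {G : Type*} [Field G] (f : F →+* G) (A : Matrix (κ × Fin 2) (κ × Fin 2) F) :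
    pfaffian (A.map f) = f (pfaffian A) := by
  have h2 : f 2 = 2 := map_ofNat f 2
  simp [pfaffian, h2]

theorem pfaffian_reindex {κ' : Type*} [Fintype κ'] [DecidableEq κ'] (e : κ' ≃ κ)
    (A : Matrix (κ × Fin 2) (κ × Fin 2) F) :
    pfaffian (A.submatrix (Prod.map e id) (Prod.map e id)) = pfaffian A := by
  unfold pfaffian
  rw [Fintype.card_congr e]
  congr 1
  rw [← (Equiv.permCongr (e.prodCongr (Equiv.refl (Fin 2)))).sum_comp]
  refine Finset.sum_congr rfl fun σ _ => ?_
  rw [Equiv.Perm.sign_permCongr, ← e.prod_comp]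
  simp [Equiv.permCongr_apply]

/-- The standard symplectic form supported on the pairs in `U`. -/
def pairForm (F : Type*) [Field F] (U : Finset κ) : Matrix (κ × Fin 2) (κ × Fin 2) F :=
  Matrix.of fun p q => if p.1 = q.1 ∧ p.1 ∈ U then !![0, 1; -1, 0] p.2 q.2 else 0

omit [Fintype κ] in
theorem pairForm_singleton_apply (k : κ) (p q : κ × Fin 2) :
    pairForm F {k} p q = (if p = (k, 0) ∧ q = (k, 1) then 1 else 0) -
      (if p = (k, 1) ∧ q = (k, 0) then 1 else 0) := by
  obtain ⟨i, a⟩ := p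
  obtain ⟨j, b⟩ := q
  fin_cases a <;> fin_cases b <;> simp [pairForm] <;> grind

/-- Exchanging two pairs is a product of two transpositions, hence even; pairs can therefore be
relabelled without signs. -/
theorem sign_prodCongr_refl_fin_two (τ : Equiv.Perm κ) :
    Equiv.Perm.sign (τ.prodCongr (Equiv.refl (Fin 2))) = 1 := by
  induction τ using Equiv.Perm.swap_induction_on with
  | one =>
    have : Equiv.prodCongr (1 : Equiv.Perm κ) (Equiv.refl (Fin 2)) = 1 := by ext p <;> simp
    rw [this, map_one]
  | swap_mul f x y hxy ih =>
    have : Equiv.prodCongr (Equiv.swap x y * f) (Equiv.refl (Fin 2)) =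
        (Equiv.swap (x, 0) (y, 0) * Equiv.swap (x, 1) (y, 1)) *
          f.prodCongr (Equiv.refl (Fin 2)) := by
      ext1 ⟨i, a⟩
      simp only [Equiv.prodCongr_apply, Prod.map, Equiv.Perm.mul_apply, Equiv.refl_apply]
      generalize f i = j
      fin_cases a <;> simp [Equiv.swap_apply_def] <;> grind
    rw [this, map_mul, map_mul, ih, Equiv.Perm.sign_swap (by simpa using hxy),
      Equiv.Perm.sign_swap (by simpa using hxy)]
    rfl

/-- The sum over the permutations that fix the pair `k`. -/
theorem sum_perm_fixing_pair (A : Matrix (κ × Fin 2) (κ × Fin 2) F) (k : κ) :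
    ∑ σ : Equiv.Perm (κ × Fin 2), ((Equiv.Perm.sign σ : ℤ) : F) *
      ((if σ (k, 0) = (k, 0) ∧ σ (k, 1) = (k, 1) then 1 else 0) *
        ∏ j ∈ Finset.univ.erase k, A (σ (j, 0)) (σ (j, 1))) =
    ∑ τ : Equiv.Perm ({i // i ≠ k} × Fin 2), ((Equiv.Perm.sign τ : ℤ) : F) *
      ∏ j : {i // i ≠ k},
        A.submatrix (Prod.map (↑) id) (Prod.map (↑) id) (τ (j, 0)) (τ (j, 1)) := by
  let f : {i // i ≠ k} × Fin 2 ≃ {p : κ × Fin 2 // p.1 ≠ k} :=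
    { toFun := fun p => ⟨(p.1, p.2), p.1.2⟩
      invFun := fun p => (⟨p.1.1, p.2⟩, p.1.2)
      left_inv := fun _ => rfl
      right_inv := fun _ => rfl }
  have hval : ∀ (τ : Equiv.Perm ({i // i ≠ k} × Fin 2)) (j : {i // i ≠ k}) (a : Fin 2),
      τ.extendDomain f (j, a) = Prod.map (↑) id (τ (j, a)) := fun τ j a =>
    τ.extendDomain_apply_image f (j, a)
  have hterm : ∀ τ : Equiv.Perm ({i // i ≠ k} × Fin 2), ((Equiv.Perm.sign τ : ℤ) : F) *
      ∏ j : {i // i ≠ k},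
        A.submatrix (Prod.map (↑) id) (Prod.map (↑) id) (τ (j, 0)) (τ (j, 1)) =
      ((Equiv.Perm.sign (τ.extendDomain f) : ℤ) : F) *
      ((if τ.extendDomain f (k, 0) = (k, 0) ∧ τ.extendDomain f (k, 1) = (k, 1) then 1 else 0) *
        ∏ j ∈ Finset.univ.erase k, A (τ.extendDomain f (j, 0)) (τ.extendDomain f (j, 1))) := by
    intro τ
    have h0 : ∀ a, τ.extendDomain f (k, a) = (k, a) := fun a =>
      Equiv.Perm.extendDomain_apply_not_subtype _ _ (by simp)
    rw [if_pos ⟨h0 0, h0 1⟩, one_mul, Equiv.Perm.sign_extendDomain]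
    congr 1
    rw [Finset.prod_subtype (p := fun i => i ≠ k) _ (by simp)]
    refine Finset.prod_congr rfl fun j _ => ?_
    rw [hval, hval]
    rfl
  symm
  refine Finset.sum_bij_ne_zero (fun τ _ _ => τ.extendDomain f)
    (fun _ _ _ => Finset.mem_univ _) ?_ ?_ ?_
  · intro τ _ _ τ' _ _ h
    exact Equiv.Perm.extendDomainHom_injective f h
  · intro σ _ hσ
    have hfix : σ (k, 0) = (k, 0) ∧ σ (k, 1) = (k, 1) := by
      by_contra hn
      simp [hn] at hσ
    have hk : ∀ a, σ (k, a) = (k, a) := by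
      intro a; fin_cases a
      exacts [hfix.1, hfix.2]
    -- A permutation fixing both points of the pair preserves the complement, so it is the extension
    -- of a permutation there.
    have hp : ∀ p : κ × Fin 2, (σ p).1 ≠ k ↔ p.1 ≠ k := by
      intro p
      refine not_congr ⟨fun h => ?_, fun h => ?_⟩
      · have : σ p = σ (k, (σ p).2) := by rw [hk, ← h]
        rw [σ.injective this]
      · obtain ⟨i, a⟩ := p
        simp only at h
        rw [h, hk]
    have hext : (f.symm.permCongr (σ.subtypePerm hp)).extendDomain f = σ := by
      ext1 ⟨i, a⟩
      by_cases hi : i = k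
      · rw [Equiv.Perm.extendDomain_apply_not_subtype _ _ (by simpa using hi), hi, hk]
      · exact (hval _ ⟨i, hi⟩ a).trans (by simp [f, Equiv.permCongr_apply])
    exact ⟨_, Finset.mem_univ _, by rwa [hterm, hext], hext⟩
  · exact fun τ _ _ => hterm τ

/-- Only permutations taking pair `i` onto pair `k` contribute. An even relabelling reduces to `i =
k`; the two orientations of the pair then contribute equally, because the sign of the flip cancels
the skew sign of the form. Hence the factor `2`. -/
theorem sum_perm_pairForm_singleton (A : Matrix (κ × Fin 2) (κ × Fin 2) F) (k i : κ) :
    ∑ σ : Equiv.Perm (κ × Fin 2), ((Equiv.Perm.sign σ : ℤ) : F) *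
      (pairForm F {k} (σ (i, 0)) (σ (i, 1)) *
        ∏ j ∈ Finset.univ.erase i, A (σ (j, 0)) (σ (j, 1))) =
    2 * ∑ τ : Equiv.Perm ({i // i ≠ k} × Fin 2), ((Equiv.Perm.sign τ : ℤ) : F) *
      ∏ j : {i // i ≠ k},
        A.submatrix (Prod.map (↑) id) (Prod.map (↑) id) (τ (j, 0)) (τ (j, 1)) := by
  have hik : ∑ σ : Equiv.Perm (κ × Fin 2), ((Equiv.Perm.sign σ : ℤ) : F) *
      (pairForm F {k} (σ (i, 0)) (σ (i, 1)) *
        ∏ j ∈ Finset.univ.erase i, A (σ (j, 0)) (σ (j, 1))) =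
      ∑ σ : Equiv.Perm (κ × Fin 2), ((Equiv.Perm.sign σ : ℤ) : F) *
      (pairForm F {k} (σ (k, 0)) (σ (k, 1)) *
        ∏ j ∈ Finset.univ.erase k, A (σ (j, 0)) (σ (j, 1))) := by
    rw [← Equiv.sum_comp (Equiv.mulRight ((Equiv.swap i k).prodCongr (Equiv.refl (Fin 2))))]
    refine Finset.sum_congr rfl fun σ _ => ?_
    rw [Equiv.coe_mulRight, Equiv.Perm.sign_mul, sign_prodCongr_refl_fin_two, mul_one]
    simp only [Equiv.Perm.mul_apply, Equiv.prodCongr_apply, Prod.map, Equiv.refl_apply,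
      Equiv.swap_apply_left]
    congr 2
    refine Finset.prod_equiv (Equiv.swap i k) ?_ (fun _ _ => rfl)
    intro j
    simp [Equiv.swap_apply_eq_iff]
  have hflip : ∑ σ : Equiv.Perm (κ × Fin 2), ((Equiv.Perm.sign σ : ℤ) : F) *
      ((if σ (k, 0) = (k, 1) ∧ σ (k, 1) = (k, 0) then 1 else 0) *
        ∏ j ∈ Finset.univ.erase k, A (σ (j, 0)) (σ (j, 1))) =
      -∑ σ : Equiv.Perm (κ × Fin 2), ((Equiv.Perm.sign σ : ℤ) : F) *
      ((if σ (k, 0) = (k, 0) ∧ σ (k, 1) = (k, 1) then 1 else 0) *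
        ∏ j ∈ Finset.univ.erase k, A (σ (j, 0)) (σ (j, 1))) := by
    rw [← Equiv.sum_comp (Equiv.mulRight (Equiv.swap ((k, 0) : κ × Fin 2) (k, 1))),
      ← Finset.sum_neg_distrib]
    refine Finset.sum_congr rfl fun σ _ => ?_
    rw [Equiv.coe_mulRight, Equiv.Perm.sign_mul, Equiv.Perm.sign_swap (by simp)]
    have hprod : ∏ j ∈ Finset.univ.erase k,
        A ((σ * Equiv.swap ((k, 0) : κ × Fin 2) (k, 1)) (j, 0))
          ((σ * Equiv.swap ((k, 0) : κ × Fin 2) (k, 1)) (j, 1)) =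
        ∏ j ∈ Finset.univ.erase k, A (σ (j, 0)) (σ (j, 1)) := by
      refine Finset.prod_congr rfl fun j hj => ?_
      have hjk : j ≠ k := Finset.ne_of_mem_erase hj
      rw [Equiv.Perm.mul_apply, Equiv.Perm.mul_apply,
        Equiv.swap_apply_of_ne_of_ne (by simp [hjk]) (by simp [hjk]),
        Equiv.swap_apply_of_ne_of_ne (by simp [hjk]) (by simp [hjk])]
    rw [hprod]
    simp only [Equiv.Perm.mul_apply, Equiv.swap_apply_left, Equiv.swap_apply_right,
      and_comm (a := σ (k, 1) = (k, 1))]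
    push_cast
    ring
  rw [hik]
  simp only [pairForm_singleton_apply, sub_mul, mul_sub, Finset.sum_sub_distrib]
  rw [hflip, sum_perm_fixing_pair]
  ring

/-- Expansion of the Pfaffian along one pair. -/
theorem pfaffian_add_pairForm_singleton [CharZero F] (A : Matrix (κ × Fin 2) (κ × Fin 2) F)
    (k : κ) :
    pfaffian (A + pairForm F {k}) = pfaffian A +
      pfaffian (A.submatrix (Prod.map ((↑) : {i // i ≠ k} → κ) id) (Prod.map (↑) id)) := by
  have hprod : ∀ σ : Equiv.Perm (κ × Fin 2),
      ∏ i, (A + pairForm F {k}) (σ (i, 0)) (σ (i, 1)) =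
        ∏ i, A (σ (i, 0)) (σ (i, 1)) +
          ∑ i, pairForm F {k} (σ (i, 0)) (σ (i, 1)) *
            ∏ j ∈ Finset.univ.erase i, A (σ (j, 0)) (σ (j, 1)) := by
    intro σ
    -- Only the pair containing the preimage of `(k, 0)` can meet the added form, so the product is
    -- affine in that form.
    set i₀ := (σ.symm (k, 0)).1 with hi₀
    have hz : ∀ i, i ≠ i₀ → pairForm F {k} (σ (i, 0)) (σ (i, 1)) = 0 := by
      intro i hi
      rw [pairForm_singleton_apply, if_neg, if_neg, sub_zero]
      · rintro ⟨-, h⟩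
        exact hi (by rw [hi₀, ← h]; simp)
      · rintro ⟨h, -⟩
        exact hi (by rw [hi₀, ← h]; simp)
    rw [Finset.sum_eq_single i₀ (fun i _ hi => by rw [hz i hi, zero_mul]) (by simp),
      ← Finset.mul_prod_erase _ _ (Finset.mem_univ i₀),
      ← Finset.mul_prod_erase _ (fun i => A (σ (i, 0)) (σ (i, 1))) (Finset.mem_univ i₀),
      ← add_mul, Matrix.add_apply]
    congr 1
    refine Finset.prod_congr rfl fun j hj => ?_
    rw [Matrix.add_apply, hz j (Finset.ne_of_mem_erase hj), add_zero]
  have hcard : Fintype.card κ = Fintype.card {i // i ≠ k} + 1 := by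
    have : 0 < Fintype.card κ := Fintype.card_pos_iff.2 ⟨k⟩
    have := Fintype.card_subtype_compl (fun i => i = k)
    simp only [Fintype.card_subtype_eq] at this
    simp only [ne_eq]
    omega
  unfold pfaffian
  simp only [hprod, mul_add, Finset.sum_add_distrib]
  congr 1
  have hsum : ∑ σ : Equiv.Perm (κ × Fin 2), ((Equiv.Perm.sign σ : ℤ) : F) *
      ∑ i, pairForm F {k} (σ (i, 0)) (σ (i, 1)) *
        ∏ j ∈ Finset.univ.erase i, A (σ (j, 0)) (σ (j, 1)) =
      ∑ i, ∑ σ : Equiv.Perm (κ × Fin 2), ((Equiv.Perm.sign σ : ℤ) : F) *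
        (pairForm F {k} (σ (i, 0)) (σ (i, 1)) *
          ∏ j ∈ Finset.univ.erase i, A (σ (j, 0)) (σ (j, 1))) := by
    simp only [Finset.mul_sum]
    exact Finset.sum_comm
  rw [hsum]
  simp only [sum_perm_pairForm_singleton, Finset.sum_const, Finset.card_univ, nsmul_eq_mul]
  -- With `n + 1` pairs in all, the `n + 1` choices of `i` and the factor `2` turn the normalization
  -- `2^(n+1) (n+1)!` into `2^n n!`.
  rw [hcard, Nat.factorial_succ, pow_succ]
  generalize Fintype.card {i // i ≠ k} = n
  have : (n.factorial : F) ≠ 0 := Nat.cast_ne_zero.2 n.factorial_ne_zero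
  have : ((n + 1 : ℕ) : F) ≠ 0 := Nat.cast_ne_zero.2 n.succ_ne_zero
  push_cast at this ⊢
  field_simp

/-- The principal submatrix on the pairs in `S`. -/
abbrev pairMinor (A : Matrix (κ × Fin 2) (κ × Fin 2) F) (S : Finset κ) :
    Matrix (S × Fin 2) (S × Fin 2) F :=
  A.submatrix (Prod.map (↑) id) (Prod.map (↑) id)

omit [Fintype κ] in
theorem pfaffian_pairMinor_add_insert [CharZero F] (A : Matrix (κ × Fin 2) (κ × Fin 2) F)
    {S U : Finset κ} {k : κ} (hkS : k ∈ S) (hkU : k ∉ U) :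
    pfaffian (pairMinor (A + pairForm F (insert k U)) S) =
      pfaffian (pairMinor (A + pairForm F U) S) +
        pfaffian (pairMinor (A + pairForm F U) (S.erase k)) := by
  have h1 : pairMinor (A + pairForm F (insert k U)) S =
      pairMinor (A + pairForm F U) S + pairForm F {(⟨k, hkS⟩ : S)} := by
    ext ⟨⟨i, hi⟩, a⟩ ⟨⟨j, hj⟩, b⟩
    simp only [pairMinor, pairForm, Matrix.submatrix_apply, Matrix.add_apply, Matrix.of_apply,
      Prod.map, Finset.mem_insert, Finset.mem_singleton, Subtype.mk.injEq, id]
    by_cases hik : i = k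
    · subst hik
      simp [hkU]
    · simp [hik]
  rw [h1, pfaffian_add_pairForm_singleton]
  congr 1
  let e : (S.erase k : Finset κ) ≃ {i : S // i ≠ ⟨k, hkS⟩} :=
    { toFun := fun i => ⟨⟨i, Finset.mem_of_mem_erase i.2⟩, fun h =>
        Finset.ne_of_mem_erase i.2 (congrArg Subtype.val h)⟩
      invFun := fun i => ⟨i.1, Finset.mem_erase.2 ⟨fun h => i.2 (Subtype.ext h), i.1.2⟩⟩
      left_inv := fun _ => rfl
      right_inv := fun _ => rfl }
  rw [← pfaffian_reindex e]
  rfl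

omit [Fintype κ] in
-- Induction on `U`, adding one pair at a time; `V` records the deleted pairs. The set `S` must
-- vary, since each expansion step may erase a pair from it.
theorem pfaffian_pairMinor_add_pairForm [CharZero F] (A : Matrix (κ × Fin 2) (κ × Fin 2) F)
    (U : Finset κ) : ∀ S, U ⊆ S → pfaffian (pairMinor (A + pairForm F U) S) =
      ∑ V ∈ U.powerset, pfaffian (pairMinor A (S \ V)) := by
  induction U using Finset.induction_on with
  | empty =>
    intro S _
    have : pairForm F (∅ : Finset κ) = 0 := by ext; simp [pairForm]
    rw [this, add_zero, Finset.powerset_empty, Finset.sum_singleton, Finset.sdiff_empty]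
  | insert k U hk ih =>
    intro S hS
    have hkS := hS (Finset.mem_insert_self k U)
    have hUS := (Finset.subset_insert k U).trans hS
    rw [pfaffian_pairMinor_add_insert A hkS hk, ih S hUS,
      ih (S.erase k) (Finset.subset_erase.2 ⟨hUS, hk⟩), Finset.sum_powerset_insert hk]
    congr 1
    refine Finset.sum_congr rfl fun V _ => ?_
    rw [Finset.erase_sdiff_comm, ← Finset.sdiff_insert]

/-- The Pfaffian analogue of `det (1 + A) = ∑ det A_T`. -/
theorem pfaffian_add_pairForm_univ [CharZero F] (A : Matrix (κ × Fin 2) (κ × Fin 2) F) :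
    pfaffian (A + pairForm F Finset.univ) = ∑ T : Finset κ, pfaffian (pairMinor A T) := by
  have h := pfaffian_pairMinor_add_pairForm A Finset.univ Finset.univ subset_rfl
  rw [← pfaffian_reindex (Equiv.subtypeUnivEquiv (fun x => Finset.mem_univ x) :
    (Finset.univ : Finset κ) ≃ κ)]
  refine h.trans ?_
  rw [Finset.powerset_univ]
  simp only [← Finset.compl_eq_univ_sdiff]
  -- Complementation passes from deleted pairs to retained ones.
  exact (Equiv.sum_comp (Function.Involutive.toPerm (compl : Finset κ → Finset κ) compl_involutive)
    fun T => pfaffian (pairMinor A T))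

theorem pfaffian_of_isEmpty [IsEmpty κ] (A : Matrix (κ × Fin 2) (κ × Fin 2) F) :
    pfaffian A = 1 := by
  simp [pfaffian]

theorem pfaffian_zero [Nonempty κ] : pfaffian (0 : Matrix (κ × Fin 2) (κ × Fin 2) F) = 0 := by
  simp [pfaffian, Finset.prod_const, zero_pow Fintype.card_ne_zero]

/-- Expanding around the zero matrix leaves only the empty minor. -/
theorem pfaffian_pairForm_univ [CharZero F] :
    pfaffian (pairForm F (Finset.univ : Finset κ)) = 1 := by
  rw [← zero_add (pairForm F _), pfaffian_add_pairForm_univ, Finset.sum_eq_single ∅]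
  · exact pfaffian_of_isEmpty _
  · intro T _ hT
    have := Finset.nonempty_coe_sort.2 (Finset.nonempty_iff_ne_empty.2 hT)
    exact pfaffian_zero
  · simp

/-- The Pfaffian of a direct sum of `2 × 2` skew-symmetric matrices. -/
theorem pfaffian_pairDiagonal [CharZero F] (d : κ → F) :
    pfaffian (Matrix.of fun p q : κ × Fin 2 =>
      if p.1 = q.1 then !![0, d p.1; -d p.1, 0] p.2 q.2 else 0) = ∏ k, d k := by
  -- Scaling one vector of each pair by `d k` reaches this matrix from the standard form, with
  -- determinant `∏ d k`.
  have h : (Matrix.of fun p q : κ × Fin 2 =>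
      if p.1 = q.1 then !![0, d p.1; -d p.1, 0] p.2 q.2 else 0) =
      (Matrix.diagonal fun p : κ × Fin 2 => ![d p.1, 1] p.2)ᵀ * pairForm F Finset.univ *
        Matrix.diagonal fun p : κ × Fin 2 => ![d p.1, 1] p.2 := by
    ext ⟨i, a⟩ ⟨j, b⟩
    rw [Matrix.diagonal_transpose, Matrix.mul_diagonal, Matrix.diagonal_mul]
    by_cases hij : i = j
    · subst hij
      fin_cases a <;> fin_cases b <;> simp [pairForm]
    · simp [pairForm, hij]
  rw [h, pfaffian_congruence, pfaffian_pairForm_univ, mul_one, Matrix.det_diagonal,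
    Fintype.prod_prod_type]
  simp

end Pfaffian

/-- The labels `(i, 0)` and `(i, 1)` correspond to the first and the second block. -/
def pairEquivSum (α : Type*) : α × Fin 2 ≃ α ⊕ α where
  toFun p := if p.2 = 0 then Sum.inl p.1 else Sum.inr p.1
  invFun := Sum.elim (fun i => (i, 0)) (fun i => (i, 1))
  left_inv := by rintro ⟨i, a⟩; fin_cases a <;> simp
  right_inv := by rintro (i | i) <;> simp

@[simp] theorem pairEquivSum_zero {α : Type*} (i : α) : pairEquivSum α (i, 0) = Sum.inl i := rfl

@[simp] theorem pairEquivSum_one {α : Type*} (i : α) : pairEquivSum α (i, 1) = Sum.inr i := rfl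

/-! ### Bogoliubov matrices, parity of Pfaffian processes, and limits of laws. -/

section RandomSubsets

variable {N : ℕ}

theorem swapBlocks_mul (X : Matrix (Fin N ⊕ Fin N) (Fin N ⊕ Fin N) ℂ) :
    swapBlocks N * X = X.submatrix Sum.swap id := by
  rw [← Matrix.fromBlocks_toBlocks X, swapBlocks, Matrix.fromBlocks_multiply]
  ext (i | i) (j | j) <;> simp

theorem mul_swapBlocks (X : Matrix (Fin N ⊕ Fin N) (Fin N ⊕ Fin N) ℂ) :
    X * swapBlocks N = X.submatrix id Sum.swap := by
  rw [← Matrix.fromBlocks_toBlocks X, swapBlocks, Matrix.fromBlocks_multiply]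
  ext (i | i) (j | j) <;> simp

theorem swapBlocks_mul_self : swapBlocks N * swapBlocks N = 1 := by
  simp [swapBlocks, Matrix.fromBlocks_multiply]

theorem swapBlocks_transpose : (swapBlocks N)ᵀ = swapBlocks N := by
  simp [swapBlocks, Matrix.fromBlocks_transpose]

theorem conjMat_mul {l m n : Type*} [Fintype m] (A : Matrix l m ℂ) (B : Matrix m n ℂ) :
    conjMat (A * B) = conjMat A * conjMat B :=
  Matrix.map_mul

theorem conjMat_conjMat {m n : Type*} (A : Matrix m n ℂ) : conjMat (conjMat A) = A := by
  ext; simp [conjMat]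

theorem conjMat_transpose {m n : Type*} (A : Matrix m n ℂ) : (conjMat A)ᵀ = Aᴴ := by
  ext; simp [conjMat]

theorem conjMat_conjTranspose {m n : Type*} (A : Matrix m n ℂ) : (conjMat A)ᴴ = Aᵀ := by
  ext; simp [conjMat]

/-- A unitary matrix that preserves the symmetric form `C`. -/
structure IsBogoliubov (W : Matrix (Fin N ⊕ Fin N) (Fin N ⊕ Fin N) ℂ) : Prop where
  orthogonal : Wᵀ * swapBlocks N * W = swapBlocks N
  unitary : W ∈ Matrix.unitaryGroup (Fin N ⊕ Fin N) ℂ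

namespace IsBogoliubov

variable {W : Matrix (Fin N ⊕ Fin N) (Fin N ⊕ Fin N) ℂ} (hW : IsBogoliubov W)
include hW

theorem mul_conjTranspose : W * Wᴴ = 1 := Matrix.mem_unitaryGroup_iff.1 hW.unitary

theorem conjTranspose_mul : Wᴴ * W = 1 := Matrix.mem_unitaryGroup_iff'.1 hW.unitary

theorem conjMat_mul_transpose : conjMat W * Wᵀ = 1 := by
  have h := congrArg Matrix.transpose hW.mul_conjTranspose
  rwa [Matrix.transpose_mul, Matrix.transpose_one, ← conjMat_transpose,
    Matrix.transpose_transpose] at h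

theorem transpose_mul_conjMat : Wᵀ * conjMat W = 1 :=
  mul_eq_one_comm.1 hW.conjMat_mul_transpose

/-- Unitarity turns preservation of `C` into an intertwining relation between `Wᵀ` and `Wᴴ`: the
particle-hole symmetry. -/
theorem swapBlocks_mul_transpose : swapBlocks N * Wᵀ = Wᴴ * swapBlocks N := by
  have h : (Wᵀ * swapBlocks N * W) * Wᴴ * swapBlocks N = Wᵀ := by
    rw [mul_assoc (Wᵀ * swapBlocks N), hW.mul_conjTranspose, mul_one, mul_assoc,
      swapBlocks_mul_self, mul_one]
  rw [← h, hW.orthogonal, ← mul_assoc, ← mul_assoc, swapBlocks_mul_self, one_mul]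

theorem mul_swapBlocks : W * swapBlocks N = swapBlocks N * conjMat W := by
  have h := congrArg Matrix.transpose hW.swapBlocks_mul_transpose
  rwa [Matrix.transpose_mul, Matrix.transpose_mul, swapBlocks_transpose, ← conjMat_transpose,
    Matrix.transpose_transpose, Matrix.transpose_transpose] at h

theorem det_eq : W.det = 1 ∨ W.det = -1 := by
  have h := congrArg Matrix.det hW.orthogonal
  rw [Matrix.det_mul, Matrix.det_mul, Matrix.det_transpose] at h
  have hC : (swapBlocks N).det ≠ 0 := by
    have h1 := congrArg Matrix.det (swapBlocks_mul_self (N := N))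
    rw [Matrix.det_mul, Matrix.det_one] at h1
    exact left_ne_zero_of_mul_eq_one h1
  have h2 : W.det * W.det = 1 := mul_right_cancel₀ hC (by linear_combination h)
  exact mul_self_eq_one_iff.1 h2

theorem det_conjMat : (conjMat W).det = W.det := by
  have h : (conjMat W).det = starRingEnd ℂ W.det := ((starRingEnd ℂ).map_det W).symm
  rw [h]
  rcases hW.det_eq with h | h <;> simp [h]

end IsBogoliubov

/-- The matrix `diag (1 - f, f)`. -/
def occupation (f : Fin N → ℂ) : Matrix (Fin N ⊕ Fin N) (Fin N ⊕ Fin N) ℂ :=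
  Matrix.fromBlocks (Matrix.diagonal fun k => 1 - f k) 0 0 (Matrix.diagonal f)

theorem pfaffian_fromBlocks_diagonal (d : Fin N → ℂ) :
    pfaffian ((Matrix.fromBlocks 0 (Matrix.diagonal d) (-Matrix.diagonal d) 0).submatrix
      (pairEquivSum (Fin N)) (pairEquivSum (Fin N))) = ∏ k, d k := by
  rw [← pfaffian_pairDiagonal]
  congr 1
  ext ⟨i, a⟩ ⟨j, b⟩
  fin_cases a <;> fin_cases b <;> simp [Matrix.diagonal_apply]

theorem pfaffian_submatrix_congruence (X B : Matrix (Fin N ⊕ Fin N) (Fin N ⊕ Fin N) ℂ) :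
    pfaffian ((Bᵀ * X * B).submatrix (pairEquivSum (Fin N)) (pairEquivSum (Fin N))) =
      B.det * pfaffian (X.submatrix (pairEquivSum (Fin N)) (pairEquivSum (Fin N))) := by
  rw [← Matrix.submatrix_mul_equiv _ _ _ (pairEquivSum (Fin N)),
    ← Matrix.submatrix_mul_equiv _ _ _ (pairEquivSum (Fin N)), ← Matrix.transpose_submatrix,
    pfaffian_congruence, Matrix.det_submatrix_equiv_self]

/-- The full matrix of a matrix-valued kernel. -/
def kernelMatrix (K : Fin N → Fin N → Matrix (Fin 2) (Fin 2) ℂ) :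
    Matrix (Fin N × Fin 2) (Fin N × Fin 2) ℂ :=
  Matrix.of fun p q => K p.1 q.1 p.2 q.2

/-- The `-δ` in the lower left kernel entry, multiplied by `-2`, turns the `-1` of the symplectic
form into `+1`; so both off-diagonal entries become `δ - 2S`. -/
theorem neg_two_smul_kernelMatrix_add (S : Matrix (Fin N ⊕ Fin N) (Fin N ⊕ Fin N) ℂ) :
    (-2 : ℂ) • kernelMatrix (kernelOf S) + pairForm ℂ Finset.univ =
      (swapBlocks N * (1 - (2 : ℂ) • S)).submatrix
        (pairEquivSum (Fin N)) (pairEquivSum (Fin N)) := by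
  rw [swapBlocks_mul]
  ext ⟨i, a⟩ ⟨j, b⟩
  fin_cases a <;> fin_cases b <;>
    simp [kernelMatrix, kernelOf, pairForm, Matrix.toBlocks₁₁, Matrix.toBlocks₁₂,
      Matrix.toBlocks₂₁, Matrix.toBlocks₂₂, Matrix.one_apply]
  · split_ifs <;> ring
  · split_ifs <;> ring

theorem sum_pfCorrelation_of_isBogoliubov {W : Matrix (Fin N ⊕ Fin N) (Fin N ⊕ Fin N) ℂ}
    (hW : IsBogoliubov W) (f : Fin N → ℂ) :
    ∑ T : Finset (Fin N), (-2 : ℂ) ^ T.card *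
      pfCorrelation (kernelOf (Wᵀ * occupation f * conjMat W)) T =
      W.det * ∏ k, (1 - 2 * f k) := by
  set S := Wᵀ * occupation f * conjMat W with hS
  have h1 : ∀ T : Finset (Fin N), (-2 : ℂ) ^ T.card * pfCorrelation (kernelOf S) T =
      pfaffian (pairMinor ((-2 : ℂ) • kernelMatrix (kernelOf S)) T) := by
    intro T
    have : pairMinor ((-2 : ℂ) • kernelMatrix (kernelOf S)) T =
      (-2 : ℂ) • kernelMinor (kernelOf S) T := rfl
    rw [this, pfaffian_smul, Fintype.card_coe, pfCorrelation]
  -- Moving `C` past `Wᵀ` produces `Wᴴ = (conj W)ᵀ`, so the similarity defining `S` becomes a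
  -- congruence.
  have h2 : swapBlocks N * (1 - (2 : ℂ) • S) = (conjMat W)ᵀ *
      Matrix.fromBlocks 0 (Matrix.diagonal fun k => 1 - 2 * f k)
        (-Matrix.diagonal fun k => 1 - 2 * f k) 0 * conjMat W := by
    have h3 : Matrix.fromBlocks 0 (Matrix.diagonal fun k => 1 - 2 * f k)
        (-Matrix.diagonal fun k => 1 - 2 * f k) 0 =
        swapBlocks N * (1 - (2 : ℂ) • occupation f) := by
      rw [swapBlocks_mul]
      ext (i | i) (j | j) <;>
        simp [occupation, Matrix.diagonal_apply, Matrix.one_apply] <;> split_ifs <;> ring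
    rw [h3, conjMat_transpose, ← mul_assoc, ← hW.swapBlocks_mul_transpose, mul_assoc, mul_assoc,
      hS]
    congr 1
    rw [sub_mul, mul_sub, one_mul, hW.transpose_mul_conjMat, smul_mul_assoc, mul_smul_comm,
      mul_assoc]
  simp only [h1]
  rw [← pfaffian_add_pairForm_univ, neg_two_smul_kernelMatrix_add, h2,
    pfaffian_submatrix_congruence, pfaffian_fromBlocks_diagonal, hW.det_conjMat]

theorem PMF.toReal_toOuterMeasure_superset {ι : Type*} [Fintype ι] [DecidableEq ι]
    (μ : PMF (Finset ι)) (T : Finset ι) :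
    (μ.toOuterMeasure {Y | T ⊆ Y}).toReal = ∑ Y, if T ⊆ Y then (μ Y).toReal else 0 := by
  rw [PMF.toOuterMeasure_apply_fintype, ENNReal.toReal_sum]
  · refine Finset.sum_congr rfl fun Y _ => ?_
    by_cases h : T ⊆ Y <;> simp [h]
  · intro Y _
    by_cases h : T ⊆ Y <;> simp [h, μ.apply_ne_top]

/-- The binomial identity `(1 + (-2))^|Y| = ∑_{T ⊆ Y} (-2)^|T|`, averaged over `Y`. -/
theorem expectedParity_eq_sum (μ : PMF (Finset (Fin N))) :
    expectedParity μ =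
      ∑ T : Finset (Fin N), (-2) ^ T.card * (μ.toOuterMeasure {Y | T ⊆ Y}).toReal := by
  simp only [PMF.toReal_toOuterMeasure_superset, Finset.mul_sum]
  rw [Finset.sum_comm, expectedParity]
  refine Finset.sum_congr rfl fun Y _ => ?_
  have h := Finset.sum_pow_mul_eq_add_pow (-2 : ℝ) 1 Y
  norm_num at h
  rw [← h, Finset.mul_sum, ← Finset.sum_subset (Finset.subset_univ Y.powerset)]
  · refine Finset.sum_congr rfl fun T hT => ?_
    rw [if_pos (Finset.mem_powerset.1 hT), mul_comm]
  · intro T _ hT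
    rw [if_neg (fun h => hT (Finset.mem_powerset.2 h)), mul_zero]

theorem IsPfPP.expectedParity_eq {W : Matrix (Fin N ⊕ Fin N) (Fin N ⊕ Fin N) ℂ}
    (hW : IsBogoliubov W) (f : Fin N → ℂ) {μ : PMF (Finset (Fin N))}
    (hμ : IsPfPP (kernelOf (Wᵀ * occupation f * conjMat W)) μ) :
    (expectedParity μ : ℂ) = W.det * ∏ k, (1 - 2 * f k) := by
  rw [← sum_pfCorrelation_of_isBogoliubov hW, expectedParity_eq_sum]
  push_cast
  simp only [hμ.2]

/-- If the expected parity is a sign, then the parity is almost surely constant. -/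
theorem neg_one_pow_card_eq_expectedParity {μ : PMF (Finset (Fin N))}
    (h : expectedParity μ = 1 ∨ expectedParity μ = -1) {Y : Finset (Fin N)}
    (hY : Y ∈ μ.support) : (-1 : ℝ) ^ Y.card = expectedParity μ := by
  have hpos : 0 < (μ Y).toReal :=
    ENNReal.toReal_pos ((μ.mem_support_iff Y).1 hY) (μ.apply_ne_top Y)
  have hsum : ∑ Z, (μ Z).toReal = 1 := by
    rw [← ENNReal.toReal_sum (fun Z _ => μ.apply_ne_top Z),
      ← tsum_fintype (L := .unconditional _), μ.tsum_coe, ENNReal.toReal_one]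
  have hsq : expectedParity μ * expectedParity μ = 1 := by
    rcases h with h | h <;> rw [h] <;> norm_num
  -- The weighted deviations from the expected sign are nonnegative and sum to zero, so each
  -- vanishes.
  have hone : ∑ Z, (μ Z).toReal * (1 - (-1) ^ Z.card * expectedParity μ) = 0 := by
    simp only [mul_sub, mul_one, Finset.sum_sub_distrib, hsum, ← mul_assoc]
    rw [← Finset.sum_mul]
    change 1 - expectedParity μ * expectedParity μ = 0
    rw [hsq, sub_self]
  have hp : ∀ Z : Finset (Fin N), (-1 : ℝ) ^ Z.card * expectedParity μ ≤ 1 := by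
    intro Z
    rcases neg_one_pow_eq_or ℝ Z.card with h1 | h1 <;> rcases h with h | h <;> rw [h1, h] <;>
      norm_num
  have h0 := (Finset.sum_eq_zero_iff_of_nonneg (fun Z _ =>
    mul_nonneg ENNReal.toReal_nonneg (sub_nonneg.2 (hp Z)))).1 hone Y (Finset.mem_univ _)
  have h1 := (mul_eq_zero.1 h0).resolve_left hpos.ne'
  calc (-1 : ℝ) ^ Y.card = (-1) ^ Y.card * expectedParity μ * expectedParity μ := by
        rw [mul_assoc, hsq, mul_one]
    _ = expectedParity μ := by rw [← sub_eq_zero.1 h1, one_mul]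

/-- Puts the projection in the form of the thermal matrices, with the indicator of `C` as occupation
numbers. -/
theorem projS_eq (W : Matrix (Fin N ⊕ Fin N) (Fin N ⊕ Fin N) ℂ) (C : Finset (Fin N)) :
    projS W C = Wᵀ * occupation (fun k => if k ∈ C then 1 else 0) * conjMat W := by
  rw [projS, conjMat_conjTranspose, occupation]
  congr 4
  ext k
  split_ifs <;> simp

theorem prod_one_sub_two_mul_ite (C : Finset (Fin N)) :
    ∏ k : Fin N, (1 - 2 * (if k ∈ C then 1 else 0 : ℂ)) = (-1) ^ C.card := by
  rw [← Finset.prod_const, ← Finset.prod_subset (Finset.subset_univ C)]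
  · refine Finset.prod_congr rfl fun k hk => ?_
    rw [if_pos hk]; norm_num
  · intro k _ hk
    simp [hk]

section Projection

variable {W : Matrix (Fin N ⊕ Fin N) (Fin N ⊕ Fin N) ℂ} (hW : IsBogoliubov W)
  (C : Finset (Fin N))

theorem projS_isHermitian : (projS W C).IsHermitian := by
  rw [Matrix.IsHermitian, projS, Matrix.conjTranspose_mul, Matrix.conjTranspose_mul,
    Matrix.conjTranspose_conjTranspose, mul_assoc]
  congr 2
  rw [Matrix.fromBlocks_conjTranspose, Matrix.diagonal_conjTranspose,
    Matrix.diagonal_conjTranspose, Matrix.conjTranspose_zero]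
  congr 2 <;> ext k <;> simp only [Pi.star_apply] <;> split_ifs <;> simp

include hW

theorem projS_mul_self : projS W C * projS W C = projS W C := by
  rw [projS_eq]
  set P := occupation (N := N) (fun k => if k ∈ C then 1 else 0) with hP
  have hPP : P * P = P := by
    rw [hP, occupation, Matrix.fromBlocks_multiply]
    simp
    intro k
    split_ifs <;> simp
  calc Wᵀ * P * conjMat W * (Wᵀ * P * conjMat W)
      = Wᵀ * P * (conjMat W * Wᵀ) * P * conjMat W := by simp only [mul_assoc]
    _ = Wᵀ * P * conjMat W := by rw [hW.conjMat_mul_transpose, mul_one, mul_assoc Wᵀ, hPP]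

/-- Exchanging the blocks exchanges occupied and empty modes, and `W C = C conj W` carries this over
to the conjugated projection. -/
theorem swapBlocks_mul_conjMat_projS :
    swapBlocks N * conjMat (projS W C) * swapBlocks N = 1 - projS W C := by
  rw [projS_eq, conjMat_mul, conjMat_mul, conjMat_conjMat]
  set P := occupation (N := N) (fun k => if k ∈ C then 1 else 0) with hP
  have h1 : conjMat Wᵀ = Wᴴ := by ext; simp [conjMat]
  have h2 : swapBlocks N * conjMat P * swapBlocks N = 1 - P := by
    rw [swapBlocks_mul, _root_.mul_swapBlocks]
    ext (i | i) (j | j) <;> by_cases hi : i ∈ C <;> rcases eq_or_ne i j with rfl | hij <;>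
      simp [occupation, conjMat, *]
  have h3 : swapBlocks N * Wᴴ = Wᵀ * swapBlocks N := by
    calc swapBlocks N * Wᴴ = swapBlocks N * (Wᴴ * swapBlocks N) * swapBlocks N := by
          rw [mul_assoc, mul_assoc, swapBlocks_mul_self, mul_one]
      _ = Wᵀ * swapBlocks N := by
          rw [← hW.swapBlocks_mul_transpose, ← mul_assoc, swapBlocks_mul_self, one_mul]
  rw [h1]
  calc swapBlocks N * (Wᴴ * conjMat P * W) * swapBlocks N
      = (swapBlocks N * Wᴴ) * conjMat P * (W * swapBlocks N) := by simp only [mul_assoc]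
    _ = Wᵀ * (swapBlocks N * conjMat P * swapBlocks N) * conjMat W := by
        rw [h3, hW.mul_swapBlocks]; simp only [mul_assoc]
    _ = 1 - Wᵀ * P * conjMat W := by
        rw [h2, mul_sub, sub_mul, mul_one, hW.transpose_mul_conjMat]

/-- For Hermitian `S`, `conj S = Sᵀ`, so particle-hole symmetry read block by block is skewness of
the kernel. It is needed to certify the limit law as a Pfaffian process. -/
theorem kernelOf_projS_transpose (i j : Fin N) :
    (kernelOf (projS W C) i j)ᵀ = -kernelOf (projS W C) j i := by
  have h := swapBlocks_mul_conjMat_projS hW C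
  have h' : conjMat (projS W C) = (projS W C)ᵀ := by
    rw [← Matrix.transpose_transpose (conjMat _), conjMat_transpose, projS_isHermitian]
  rw [h', swapBlocks_mul, _root_.mul_swapBlocks] at h
  have h11 := congrFun₂ h (Sum.inl i) (Sum.inl j)
  have h22 := congrFun₂ h (Sum.inr i) (Sum.inr j)
  have h12 := congrFun₂ h (Sum.inl j) (Sum.inr i)
  have h21 := congrFun₂ h (Sum.inr j) (Sum.inl i)
  simp [Matrix.one_apply] at h11 h12 h21 h22
  ext a b
  fin_cases a <;> fin_cases b <;>
    simp [kernelOf, Matrix.toBlocks₁₁, Matrix.toBlocks₁₂, Matrix.toBlocks₂₁, Matrix.toBlocks₂₂,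
      Matrix.one_apply, h11, h12, h21, h22, eq_comm]

end Projection

/-- If the probabilities of the events `T ⊆ Y` converge, then so do those of the events `Y = T`. -/
theorem exists_tendsto_of_tendsto_superset {ι α : Type*} [Fintype ι] [DecidableEq ι]
    {l : Filter α} (μ : α → PMF (Finset ι)) (c : Finset ι → ℝ)
    (h : ∀ T, Filter.Tendsto (fun a => ((μ a).toOuterMeasure {Y | T ⊆ Y}).toReal) l
      (nhds (c T))) (Y : Finset ι) :
    ∃ x : ℝ, Filter.Tendsto (fun a => (μ a Y).toReal) l (nhds x) := by
  -- Möbius inversion from the full set downwards: the mass at `Y` is the probability of containing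
  -- `Y` minus the masses of strict supersets.
  induction hn : Yᶜ.card using Nat.strong_induction_on generalizing Y with
  | _ n ih =>
    have hlt : ∀ Z, Y ⊂ Z → ∃ x : ℝ, Filter.Tendsto (fun a => (μ a Z).toReal) l (nhds x) := by
      intro Z hZ
      exact ih _ (by rw [← hn]; exact Finset.card_lt_card (compl_lt_compl_iff_lt.2 hZ)) Z rfl
    choose! x hx using hlt
    refine ⟨c Y - ∑ Z, if Y ⊂ Z then x Z else 0, ?_⟩
    have heq : ∀ a, (μ a Y).toReal = ((μ a).toOuterMeasure {Z | Y ⊆ Z}).toReal -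
        ∑ Z, if Y ⊂ Z then (μ a Z).toReal else 0 := by
      intro a
      rw [PMF.toReal_toOuterMeasure_superset, ← Finset.sum_sub_distrib,
        Finset.sum_eq_single Y]
      · simp
      · intro Z _ hZ
        by_cases hYZ : Y ⊆ Z
        · rw [if_pos hYZ, if_pos (hYZ.ssubset_of_ne hZ.symm), sub_self]
        · rw [if_neg hYZ, if_neg (fun h => hYZ h.subset), sub_self]
      · simp
    simp only [heq]
    refine (h Y).sub (tendsto_finsetSum _ fun Z _ => ?_)
    by_cases hYZ : Y ⊂ Z
    · simpa only [if_pos hYZ] using hx Z hYZ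
    · simp only [if_neg hYZ]; exact tendsto_const_nhds

/-- There are finitely many outcomes, so total mass and inclusion probabilities pass to the limit
and no mass is lost. -/
theorem exists_pmf_tendsto_of_tendsto_superset {ι α : Type*} [Fintype ι] [DecidableEq ι]
    {l : Filter α} [l.NeBot] (μ : α → PMF (Finset ι)) (c : Finset ι → ℝ)
    (h : ∀ T, Filter.Tendsto (fun a => ((μ a).toOuterMeasure {Y | T ⊆ Y}).toReal) l
      (nhds (c T))) :
    ∃ ν : PMF (Finset ι), (∀ Y, Filter.Tendsto (fun a => μ a Y) l (nhds (ν Y))) ∧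
      ∀ T, (ν.toOuterMeasure {Y | T ⊆ Y}).toReal = c T := by
  choose x hx using exists_tendsto_of_tendsto_superset μ c h
  have hx' : ∀ Y, Filter.Tendsto (fun a => μ a Y) l (nhds (ENNReal.ofReal (x Y))) := by
    intro Y
    have := (ENNReal.continuous_ofReal.tendsto _).comp (hx Y)
    refine this.congr fun a => ENNReal.ofReal_toReal ((μ a).apply_ne_top Y)
  have hsum : ∑ Y, ENNReal.ofReal (x Y) = 1 := by
    refine tendsto_nhds_unique (tendsto_finsetSum _ fun Y _ => hx' Y) ?_
    refine tendsto_const_nhds.congr fun a => ?_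
    rw [← tsum_fintype (L := .unconditional _), (μ a).tsum_coe]
  have hν : ∀ Y, Filter.Tendsto (fun a => μ a Y) l (nhds (PMF.ofFintype _ hsum Y)) := by
    simpa only [PMF.ofFintype_apply] using hx'
  refine ⟨PMF.ofFintype _ hsum, hν, fun T => ?_⟩
  refine tendsto_nhds_unique ?_ (h T)
  simp only [PMF.toReal_toOuterMeasure_superset]
  refine tendsto_finsetSum _ fun Y _ => ?_
  by_cases hTY : T ⊆ Y
  · simp only [if_pos hTY]
    exact (ENNReal.tendsto_toReal (PMF.apply_ne_top _ Y)).comp (hν Y)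
  · simp only [if_neg hTY]; exact tendsto_const_nhds

theorem tendsto_expectedParity {α : Type*} {l : Filter α} {μ : α → PMF (Finset (Fin N))}
    {ν : PMF (Finset (Fin N))} (h : ∀ Y, Filter.Tendsto (fun a => μ a Y) l (nhds (ν Y))) :
    Filter.Tendsto (fun a => expectedParity (μ a)) l (nhds (expectedParity ν)) :=
  tendsto_finsetSum _ fun Y _ =>
    ((ENNReal.tendsto_toReal (ν.apply_ne_top Y)).comp (h Y)).mul_const _

theorem continuous_pfaffian {κ : Type*} [Fintype κ] [DecidableEq κ] :
    Continuous fun A : Matrix (κ × Fin 2) (κ × Fin 2) ℂ => pfaffian A := by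
  unfold pfaffian
  fun_prop

theorem continuous_pfCorrelation_kernelOf (T : Finset (Fin N)) :
    Continuous fun S : Matrix (Fin N ⊕ Fin N) (Fin N ⊕ Fin N) ℂ =>
      pfCorrelation (kernelOf S) T := by
  refine continuous_pfaffian.comp (continuous_matrix fun ⟨i, a⟩ ⟨j, b⟩ => ?_)
  fin_cases a <;> fin_cases b <;>
    simp [kernelMinor, kernelOf, Matrix.toBlocks₁₁, Matrix.toBlocks₁₂, Matrix.toBlocks₂₁,
      Matrix.toBlocks₂₂] <;> fun_prop

end RandomSubsets

/-! ### Quadratic forms in generators with scalar anti-commutators. -/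

section QuadraticForms

variable {ι 𝓐 : Type*} [Fintype ι] [DecidableEq ι] [Ring 𝓐] [Algebra ℂ 𝓐]

omit [DecidableEq ι] in
/-- Linear combinations of elements that satisfy anti-commutation relations. -/
theorem anticommutator_linear_combination {ι' : Type*} {x : ι → 𝓐} {G : Matrix ι ι ℂ}
    (hx : ∀ a b, x a * x b + x b * x a = G a b • 1) (V : Matrix ι' ι ℂ) (k l : ι') :
    (∑ a, V k a • x a) * (∑ b, V l b • x b) + (∑ b, V l b • x b) * (∑ a, V k a • x a) =
      (V * G * Vᵀ) k l • (1 : 𝓐) := by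
  have h1 : (∑ b, V l b • x b) * (∑ a, V k a • x a) =
      ∑ a, ∑ b, (V k a * V l b) • (x b * x a) := by
    rw [Finset.sum_mul_sum, Finset.sum_comm]
    simp only [smul_mul_smul_comm, mul_comm (V l _)]
  have h2 : (V * G * Vᵀ) k l = ∑ a, ∑ b, V k a * V l b * G a b := by
    simp only [Matrix.mul_apply, Matrix.transpose_apply, Finset.sum_mul]
    rw [Finset.sum_comm]
    exact Finset.sum_congr rfl fun a _ => Finset.sum_congr rfl fun b _ => by ring
  rw [h1, h2, Finset.sum_mul_sum]
  simp only [smul_mul_smul_comm, ← Finset.sum_add_distrib, ← smul_add, hx, smul_smul,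
    Finset.sum_smul]

omit [DecidableEq ι] in
/-- The commutator of a skew-symmetric quadratic form with a generator. -/
theorem commutator_quadratic_form {x : ι → 𝓐} {G : Matrix ι ι ℂ}
    (hx : ∀ a b, x a * x b + x b * x a = G a b • 1) {Q : Matrix ι ι ℂ}
    (hQ : Qᵀ = -Q) (r : ι) :
    ((1 / 2 : ℂ) • ∑ a, ∑ b, Q a b • (x a * x b)) * x r -
      x r * ((1 / 2 : ℂ) • ∑ a, ∑ b, Q a b • (x a * x b)) =
      ∑ p, (Q * G) p r • x p := by
  have h1 : ∀ a b, x a * x b * x r - x r * (x a * x b) = G b r • x a - G a r • x b := by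
    intro a b
    have hb : x b * x r = G b r • 1 - x r * x b := eq_sub_of_add_eq (hx b r)
    have ha : x r * x a = G a r • 1 - x a * x r := eq_sub_of_add_eq' (hx a r)
    rw [mul_assoc, hb, ← mul_assoc (x r), ha]
    simp only [mul_sub, sub_mul, mul_smul_comm, smul_mul_assoc, mul_one, one_mul, mul_assoc]
    abel
  -- Skewness makes the two halves of the commutator equal, which cancels the prefactor `1 / 2`.
  have h2 : ∑ a, ∑ b, Q a b • G a r • x b = -∑ a, ∑ b, Q a b • G b r • x a := by
    rw [Finset.sum_comm, ← Finset.sum_neg_distrib]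
    refine Finset.sum_congr rfl fun a _ => ?_
    rw [← Finset.sum_neg_distrib]
    refine Finset.sum_congr rfl fun b _ => ?_
    have : Q b a = -Q a b := congrFun₂ hQ a b
    rw [this, neg_smul]
  simp only [smul_mul_assoc, mul_smul_comm, Finset.sum_mul, Finset.mul_sum]
  rw [← smul_sub]
  simp only [← Finset.sum_sub_distrib, ← smul_sub, h1]
  simp only [smul_sub, Finset.sum_sub_distrib, h2, sub_neg_eq_add]
  rw [← two_smul ℂ, smul_smul, one_div, inv_mul_cancel₀ two_ne_zero, one_smul]
  refine Finset.sum_congr rfl fun a _ => ?_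
  simp only [Matrix.mul_apply, Finset.sum_smul, smul_smul]

omit [DecidableEq ι] in
theorem quadratic_form_linear_combination (Q U : Matrix ι ι ℂ) (y : ι → 𝓐) :
    ∑ a, ∑ b, Q a b • ((∑ p, U a p • y p) * ∑ q, U b q • y q) =
      ∑ p, ∑ q, (Uᵀ * Q * U) p q • (y p * y q) := by
  have h2 : ∀ p q, (Uᵀ * Q * U) p q = ∑ a, ∑ b, Q a b * (U a p * U b q) := by
    intro p q
    simp only [Matrix.mul_apply, Matrix.transpose_apply, Finset.sum_mul]
    rw [Finset.sum_comm]
    exact Finset.sum_congr rfl fun a _ => Finset.sum_congr rfl fun b _ => by ring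
  simp only [Finset.sum_mul_sum, smul_mul_smul_comm, Finset.smul_sum, smul_smul, h2,
    Finset.sum_smul]
  calc _ = ∑ a, ∑ p, ∑ b, ∑ q, (Q a b * (U a p * U b q)) • (y p * y q) :=
        Finset.sum_congr rfl fun a _ => Finset.sum_comm
    _ = ∑ p, ∑ a, ∑ q, ∑ b, (Q a b * (U a p * U b q)) • (y p * y q) := by
        rw [Finset.sum_comm]
        exact Finset.sum_congr rfl fun p _ => Finset.sum_congr rfl fun a _ => Finset.sum_comm
    _ = _ := Finset.sum_congr rfl fun p _ => Finset.sum_comm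

/-- A skew-symmetric quadratic form in generators of a Clifford algebra determines its matrix. -/
theorem quadratic_form_injective [Nontrivial 𝓐] {y : ι → 𝓐}
    (hy : ∀ a b, y a * y b + y b * y a = (1 : Matrix ι ι ℂ) a b • 1)
    {Q Q' : Matrix ι ι ℂ} (hQ : Qᵀ = -Q) (hQ' : Q'ᵀ = -Q')
    (h : ∑ a, ∑ b, Q a b • (y a * y b) = ∑ a, ∑ b, Q' a b • (y a * y b)) : Q = Q' := by
  have hD : (Q - Q')ᵀ = -(Q - Q') := by
    rw [Matrix.transpose_sub, hQ, hQ']; abel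
  have h0 : ∑ a, ∑ b, (Q - Q') a b • (y a * y b) = 0 := by
    simp only [Matrix.sub_apply, sub_smul, Finset.sum_sub_distrib, h, sub_self]
  ext s r
  have h1 := commutator_quadratic_form hy hD r
  rw [h0, smul_zero, zero_mul, mul_zero, sub_zero, mul_one] at h1
  -- The commutator with `y r` gave a linear relation among the generators; its anti-commutator with
  -- `y s` isolates one coefficient.
  have h2 : ∑ p, (Q - Q') p r • (y p * y s + y s * y p) = 0 := by
    have hl : ∑ p, (Q - Q') p r • (y p * y s) = 0 := by
      simp only [← smul_mul_assoc, ← Finset.sum_mul]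
      rw [← h1, zero_mul]
    have hr : ∑ p, (Q - Q') p r • (y s * y p) = 0 := by
      simp only [← mul_smul_comm, ← Finset.mul_sum]
      rw [← h1, mul_zero]
    simp only [smul_add, Finset.sum_add_distrib, hl, hr, add_zero]
  simp only [hy, Matrix.one_apply, ite_smul, one_smul, zero_smul, smul_ite, smul_zero,
    Finset.sum_ite_eq', Finset.mem_univ, if_true] at h2
  have h3 := (smul_eq_zero.1 h2).resolve_right one_ne_zero
  exact sub_eq_zero.1 h3

end QuadraticForms

/-! ### The Hamiltonian in the Nambu field, and Gibbs states. -/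

section Operators

variable {N : ℕ} {𝓗 : Type*} [NormedAddCommGroup 𝓗] [InnerProductSpace ℂ 𝓗] [CompleteSpace 𝓗]

/-- The Nambu field `(c, c*)`. -/
def nambu (c : Fin N → 𝓗 →L[ℂ] 𝓗) : Fin N ⊕ Fin N → 𝓗 →L[ℂ] 𝓗 :=
  Sum.elim c fun i => star (c i)

theorem IsCAR.anticommutator_nambu {c : Fin N → 𝓗 →L[ℂ] 𝓗} (hc : IsCAR c)
    (a b : Fin N ⊕ Fin N) :
    nambu c a * nambu c b + nambu c b * nambu c a = swapBlocks N a b • 1 := by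
  rcases a with i | i <;> rcases b with j | j
  · simpa [nambu, swapBlocks] using hc.anticomm i j
  · simpa [nambu, swapBlocks, Matrix.one_apply] using hc.anticomm_mixed i j
  · simpa [nambu, swapBlocks, Matrix.one_apply, add_comm, eq_comm] using hc.anticomm_mixed j i
  · simpa [nambu, swapBlocks] using hc.anticomm_star i j

theorem bdgMatrix_mul_swapBlocks (M Δ : Matrix (Fin N) (Fin N) ℂ) :
    bdgMatrix M Δ * swapBlocks N = Matrix.fromBlocks (-conjMat Δ) (-conjMat M) M Δ := by
  simp [bdgMatrix, swapBlocks, Matrix.fromBlocks_multiply]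

/-- The BdG matrix pairs the Nambu field with its adjoint; the factor `C` rewrites this as a
bilinear form in the field alone, to which the commutator formula applies. -/
theorem bdgHamiltonian_eq (c : Fin N → 𝓗 →L[ℂ] 𝓗) {M : Matrix (Fin N) (Fin N) ℂ}
    (Δ : Matrix (Fin N) (Fin N) ℂ) (hM : M.IsHermitian) :
    bdgHamiltonian c M Δ = (1 / 2 : ℂ) • ∑ a, ∑ b,
      (bdgMatrix M Δ * swapBlocks N) a b • (nambu c a * nambu c b) := by
  have hM' : ∀ i j, starRingEnd ℂ (M i j) = M j i := fun i j => congrFun₂ hM j i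
  rw [bdgMatrix_mul_swapBlocks, bdgHamiltonian, ← smul_add]
  congr 1
  simp only [Fintype.sum_sum_type, nambu, Sum.elim_inl, Sum.elim_inr, Matrix.fromBlocks_apply₁₁,
    Matrix.fromBlocks_apply₁₂, Matrix.fromBlocks_apply₂₁, Matrix.fromBlocks_apply₂₂,
    Matrix.neg_apply, conjMat, Matrix.map_apply, hM', smul_sub, neg_smul,
    Finset.sum_add_distrib, Finset.sum_sub_distrib, Finset.sum_neg_distrib]
  rw [Finset.sum_comm (f := fun i j => M i j • (c j * star (c i)))]
  abel

theorem bdgMatrix_mul_swapBlocks_transpose {M Δ : Matrix (Fin N) (Fin N) ℂ}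
    (hM : M.IsHermitian) (hΔ : Δᵀ = -Δ) :
    (bdgMatrix M Δ * swapBlocks N)ᵀ = -(bdgMatrix M Δ * swapBlocks N) := by
  have hM' : ∀ i j, starRingEnd ℂ (M i j) = M j i := fun i j => congrFun₂ hM j i
  have hΔ' : ∀ i j, Δ j i = -Δ i j := fun i j => congrFun₂ hΔ i j
  rw [bdgMatrix_mul_swapBlocks]
  ext (i | i) (j | j) <;> simp [conjMat, hM', hΔ' i j]

theorem star_bdgHamiltonian (c : Fin N → 𝓗 →L[ℂ] 𝓗) {M Δ : Matrix (Fin N) (Fin N) ℂ}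
    (hM : M.IsHermitian) (hΔ : Δᵀ = -Δ) :
    star (bdgHamiltonian c M Δ) = bdgHamiltonian c M Δ := by
  have hM' : ∀ i j, starRingEnd ℂ (M i j) = M j i := fun i j => congrFun₂ hM j i
  have hΔ' : ∀ i j, Δ i j = -Δ j i := fun i j => congrFun₂ hΔ j i
  have h2 : star (1 / 2 : ℂ) = 1 / 2 := by simp
  simp only [bdgHamiltonian, star_add, star_smul, star_sum, star_sub, star_mul, star_star, h2,
    RCLike.star_def, Complex.conj_conj, hM']
  congr 2
  · rw [Finset.sum_comm]
  · rw [Finset.sum_comm]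
    refine Finset.sum_congr rfl fun i _ => Finset.sum_congr rfl fun j _ => ?_
    rw [hΔ' j i, map_neg, neg_smul, neg_smul]
    abel

section Gibbs

omit [CompleteSpace 𝓗] in
theorem opTrace_add (A B : 𝓗 →L[ℂ] 𝓗) : opTrace (A + B) = opTrace A + opTrace B := by
  simp [opTrace]

omit [CompleteSpace 𝓗] in
theorem opTrace_smul (a : ℂ) (A : 𝓗 →L[ℂ] 𝓗) : opTrace (a • A) = a * opTrace A := by
  simp [opTrace]

omit [CompleteSpace 𝓗] in
theorem opTrace_mul_comm (A B : 𝓗 →L[ℂ] 𝓗) : opTrace (A * B) = opTrace (B * A) :=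
  LinearMap.trace_mul_comm ℂ (A : 𝓗 →ₗ[ℂ] 𝓗) (B : 𝓗 →ₗ[ℂ] 𝓗)

/-- The trace against an operator, as a linear functional. -/
def opExpectation (ρ : 𝓗 →L[ℂ] 𝓗) : (𝓗 →L[ℂ] 𝓗) →ₗ[ℂ] ℂ where
  toFun A := opTrace (ρ * A)
  map_add' A B := by rw [mul_add, opTrace_add]
  map_smul' a A := by rw [mul_smul_comm, opTrace_smul, RingHom.id_apply, smul_eq_mul]

omit [CompleteSpace 𝓗] in
theorem opExpectation_apply (ρ A : 𝓗 →L[ℂ] 𝓗) : opExpectation ρ A = opTrace (ρ * A) := rfl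

theorem opTrace_star_mul_self_ne_zero [FiniteDimensional ℂ 𝓗] {A : 𝓗 →L[ℂ] 𝓗} (hA : A ≠ 0) :
    opTrace (star A * A) ≠ 0 := by
  intro h
  apply hA
  let b := stdOrthonormalBasis ℂ 𝓗
  have h1 : opTrace (star A * A) = ((∑ i, ‖A (b i)‖ ^ 2 : ℝ) : ℂ) := by
    rw [opTrace, LinearMap.trace_eq_sum_inner _ b]
    push_cast
    refine Finset.sum_congr rfl fun i _ => ?_
    have : inner ℂ (b i) ((star A * A) (b i)) = inner ℂ (A (b i)) (A (b i)) := by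
      rw [mul_apply_eq_comp, ContinuousLinearMap.star_eq_adjoint,
        ContinuousLinearMap.adjoint_inner_right]
    exact this.trans (inner_self_eq_norm_sq_to_K _)
  rw [h1, Complex.ofReal_eq_zero, Finset.sum_eq_zero_iff_of_nonneg (fun _ _ => sq_nonneg _)] at h
  have h2 : ∀ i, A (b i) = 0 := fun i => by simpa using h i (Finset.mem_univ i)
  have h3 : (A : 𝓗 →ₗ[ℂ] 𝓗) = 0 := b.toBasis.ext fun i => by simpa using h2 i
  exact ContinuousLinearMap.coe_injective h3

theorem opTrace_exp_ne_zero [FiniteDimensional ℂ 𝓗] [Nontrivial 𝓗] {H : 𝓗 →L[ℂ] 𝓗}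
    (hH : star H = H) (β : ℝ) : opTrace (NormedSpace.exp (-(β : ℂ) • H)) ≠ 0 := by
  let _ : NormedAlgebra ℚ (𝓗 →L[ℂ] 𝓗) := NormedAlgebra.restrictScalars ℚ ℂ _
  -- The half-temperature factor `exp(-βH/2)` is self-adjoint and invertible, and its square is the
  -- Gibbs weight, so the trace is a nonzero sum of squared norms.
  set A := NormedSpace.exp ((-(β : ℂ) / 2) • H) with hA
  have hstar : star A = A := by
    rw [hA, NormedSpace.star_exp, star_smul, hH]
    simp
  have hmul : NormedSpace.exp (-(β : ℂ) • H) = star A * A := by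
    rw [hstar, hA, ← NormedSpace.exp_add_of_commute (Commute.refl _), ← add_smul, add_halves]
  rw [hmul]
  exact opTrace_star_mul_self_ne_zero (NormedSpace.isUnit_exp _).ne_zero

/-- The hypothesis says `H x = x (H + e)`; exponentiating this semiconjugacy gives the scalar
factor. -/
theorem exp_smul_mul_of_commutator {H x : 𝓗 →L[ℂ] 𝓗} {e : ℂ} (h : H * x - x * H = e • x)
    (t : ℂ) :
    NormedSpace.exp (t • H) * x = Complex.exp (t * e) • (x * NormedSpace.exp (t • H)) := by
  let _ : NormedAlgebra ℚ (𝓗 →L[ℂ] 𝓗) := NormedAlgebra.restrictScalars ℚ ℂ _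
  have h1 : SemiconjBy x (t • H + (t * e) • 1) (t • H) := by
    have : H * x = x * H + e • x := by rw [← h]; abel
    rw [SemiconjBy, smul_mul_assoc, this, mul_add, mul_smul_comm, mul_smul_comm, mul_one,
      smul_add, smul_smul]
  have h2 : NormedSpace.exp (t • H + (t * e) • (1 : 𝓗 →L[ℂ] 𝓗)) =
      Complex.exp (t * e) • NormedSpace.exp (t • H) := by
    rw [NormedSpace.exp_add_of_commute ((Commute.one_right _).smul_right _),
      ← Algebra.algebraMap_eq_smul_one, ← NormedSpace.algebraMap_exp_comm,
      Algebra.algebraMap_eq_smul_one, mul_smul_comm, mul_one, Complex.exp_eq_exp_ℂ]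
  rw [← h1.exp_right.eq, h2, mul_smul_comm]

/-- The two-point function of a thermal state, from the Kubo-Martin-Schwinger condition. -/
theorem opTrace_gibbsState_mul [FiniteDimensional ℂ 𝓗] [Nontrivial 𝓗] {H x y : 𝓗 →L[ℂ] 𝓗}
    (hH : star H = H) {e : ℝ} (h : H * x - x * H = (e : ℂ) • x) {g : ℂ}
    (hxy : x * y + y * x = g • 1) (β : ℝ) :
    opTrace (gibbsState H β * (x * y)) = g * ((1 + Real.exp (β * e))⁻¹ : ℝ) := by
  have hZ := opTrace_exp_ne_zero hH β
  set E := NormedSpace.exp (-(β : ℂ) • H) with hE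
  -- KMS condition: commuting `x` through the Gibbs weight and using cyclicity gives one linear
  -- equation for the two orderings; the anti-commutator gives the other.
  have h1 : opTrace (E * (x * y)) = Complex.exp (-(β : ℂ) * e) * opTrace (E * (y * x)) := by
    rw [← mul_assoc, hE, exp_smul_mul_of_commutator h, smul_mul_assoc, opTrace_smul, mul_assoc,
      opTrace_mul_comm x, mul_assoc]
  have h2 : opTrace (E * (x * y)) + opTrace (E * (y * x)) = g * opTrace E := by
    rw [← opTrace_add, ← mul_add, hxy, mul_smul_comm, mul_one, opTrace_smul]
  have h3 : Complex.exp (-(β : ℂ) * e) = ((Real.exp (β * e))⁻¹ : ℝ) := by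
    rw [← Real.exp_neg]; push_cast; ring_nf
  have hpos := Real.exp_pos (β * e)
  have h4 : ((Real.exp (β * e) : ℝ) : ℂ) ≠ 0 := by exact_mod_cast hpos.ne'
  have h5 : (1 + (Real.exp (β * e) : ℝ) : ℂ) ≠ 0 := by
    exact_mod_cast (by positivity : (1 + Real.exp (β * e)) ≠ 0)
  rw [gibbsState, ← hE, smul_mul_assoc, opTrace_smul]
  rw [h3] at h1
  push_cast at h1 h4 h5 ⊢
  field_simp at h1 ⊢
  linear_combination h2 + h1

end Gibbs

end Operators

/-! ### Thermal two-point functions and their zero-temperature limit. -/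

section Thermal

variable {N : ℕ} {M Δ : Matrix (Fin N) (Fin N) ℂ}
  {W : Matrix (Fin N ⊕ Fin N) (Fin N ⊕ Fin N) ℂ} {ε : Fin N → ℝ}

theorem IsBogoliubovDiag.isBogoliubov (hW : IsBogoliubovDiag M Δ W ε) : IsBogoliubov W :=
  ⟨hW.orthogonal, hW.unitary⟩

/-- The rows of `conj W` are the coefficient vectors of the quasi-particle operators, eigenvectors
of the commutator with the Hamiltonian. -/
theorem IsBogoliubovDiag.conjMat_mul_bdgMatrix_transpose (hW : IsBogoliubovDiag M Δ W ε) :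
    conjMat W * (bdgMatrix M Δ)ᵀ =
      Matrix.diagonal (Sum.elim (fun k => ((-ε k : ℝ) : ℂ)) fun k => (ε k : ℂ)) * conjMat W := by
  have h1 : Matrix.fromBlocks (Matrix.diagonal fun k => -(ε k : ℂ)) 0 0
      (Matrix.diagonal fun k => (ε k : ℂ)) =
      Matrix.diagonal (Sum.elim (fun k => ((-ε k : ℝ) : ℂ)) fun k => (ε k : ℂ)) := by
    rw [Matrix.fromBlocks_diagonal]
    simp
  have h2 : (Wᴴ)ᵀ = conjMat W := by rw [← conjMat_transpose, Matrix.transpose_transpose]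
  rw [hW.diag, h1, Matrix.transpose_mul, Matrix.transpose_mul, Matrix.diagonal_transpose, h2,
    ← mul_assoc, hW.isBogoliubov.conjMat_mul_transpose, one_mul]

/-- The Fermi-Dirac distribution. -/
def fermi (ε : Fin N → ℝ) (β : ℝ) (k : Fin N) : ℂ := ((1 + Real.exp (β * ε k))⁻¹ : ℝ)

theorem one_sub_two_mul_fermi (ε : Fin N → ℝ) (β : ℝ) (k : Fin N) :
    1 - 2 * fermi ε β k = (Real.tanh (β * ε k / 2) : ℝ) := by
  have h : Real.exp (β * ε k) = Real.exp (β * ε k / 2) ^ 2 := by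
    rw [← Real.exp_nat_mul]; congr 1; push_cast; ring
  rw [fermi, Real.tanh_eq_sinh_div_cosh, Real.sinh_eq, Real.cosh_eq, h, Real.exp_neg]
  norm_cast
  have := Real.exp_pos (β * ε k / 2)
  field_simp
  ring

theorem tendsto_fermi {ε : Fin N → ℝ} {C : Finset (Fin N)} (hneg : ∀ k ∈ C, ε k < 0)
    (hpos : ∀ k, k ∉ C → 0 < ε k) (k : Fin N) :
    Filter.Tendsto (fun β => fermi ε β k) Filter.atTop (nhds (if k ∈ C then 1 else 0)) := by
  by_cases hk : k ∈ C
  · have h1 : Filter.Tendsto (fun β => Real.exp (β * ε k)) Filter.atTop (nhds 0) :=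
      Real.tendsto_exp_atBot.comp (Filter.tendsto_id.atTop_mul_const_of_neg (hneg k hk))
    have h2 : Filter.Tendsto (fun β => (1 + Real.exp (β * ε k))⁻¹) Filter.atTop (nhds 1) := by
      simpa using (tendsto_const_nhds (x := (1 : ℝ)).add h1).inv₀ (by norm_num)
    rw [if_pos hk, ← Complex.ofReal_one]
    exact (Complex.continuous_ofReal.tendsto _).comp h2
  · have h1 : Filter.Tendsto (fun β => 1 + Real.exp (β * ε k)) Filter.atTop Filter.atTop :=
      Filter.tendsto_atTop_add_const_left _ _
        (Real.tendsto_exp_atTop.comp (Filter.tendsto_id.atTop_mul_const (hpos k hk)))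
    rw [if_neg hk, ← Complex.ofReal_zero]
    exact (Complex.continuous_ofReal.tendsto _).comp h1.inv_tendsto_atTop

variable {𝓗 : Type*} [NormedAddCommGroup 𝓗] [InnerProductSpace ℂ 𝓗] [CompleteSpace 𝓗]

theorem bilinearExpectations_eq (c : Fin N → 𝓗 →L[ℂ] 𝓗) (ρ : 𝓗 →L[ℂ] 𝓗) :
    bilinearExpectations c ρ =
      Matrix.of (fun a b => opExpectation ρ (nambu c a * nambu c b)) * swapBlocks N := by
  rw [mul_swapBlocks]
  ext (i | i) (j | j) <;> simp [bilinearExpectations, nambu, opExpectation_apply]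

/-- The bilinear expectations of the thermal state of a Bogoliubov-de Gennes Hamiltonian. -/
theorem bilinearExpectations_gibbsState [FiniteDimensional ℂ 𝓗] [Nontrivial 𝓗]
    {c : Fin N → 𝓗 →L[ℂ] 𝓗} (hc : IsCAR c) (hM : M.IsHermitian) (hΔ : Δᵀ = -Δ)
    (hW : IsBogoliubovDiag M Δ W ε) (β : ℝ) :
    bilinearExpectations c (gibbsState (bdgHamiltonian c M Δ) β) =
      Wᵀ * occupation (fermi ε β) * conjMat W := by
  have hB := hW.isBogoliubov
  set H := bdgHamiltonian c M Δ with hH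
  set V := conjMat W with hV
  have hcomm : ∀ r, H * nambu c r - nambu c r * H = ∑ p, bdgMatrix M Δ p r • nambu c p := by
    intro r
    rw [hH, bdgHamiltonian_eq c Δ hM, commutator_quadratic_form hc.anticommutator_nambu
      (bdgMatrix_mul_swapBlocks_transpose hM hΔ), mul_assoc,
      swapBlocks_mul_self, mul_one]
  set E : Fin N ⊕ Fin N → ℝ := Sum.elim (fun k => -ε k) ε with hE
  have hVE : V * (bdgMatrix M Δ)ᵀ = Matrix.diagonal (fun a => (E a : ℂ)) * V := by
    rw [hV, hW.conjMat_mul_bdgMatrix_transpose]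
    congr 2
    ext (k | k) <;> simp [hE]
  have heig : ∀ k, H * (∑ a, V k a • nambu c a) - (∑ a, V k a • nambu c a) * H =
      (E k : ℂ) • ∑ a, V k a • nambu c a := by
    intro k
    simp only [Finset.mul_sum, Finset.sum_mul, mul_smul_comm, smul_mul_assoc,
      ← Finset.sum_sub_distrib, ← smul_sub, hcomm, Finset.smul_sum, smul_smul]
    rw [Finset.sum_comm]
    refine Finset.sum_congr rfl fun p _ => ?_
    rw [← Finset.sum_smul]
    congr 1
    have := congrFun₂ hVE k p
    rwa [Matrix.diagonal_mul, Matrix.mul_apply] at this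
  -- The quasi-particle operators obey the same anti-commutation relations as the original field.
  have hVC : V * swapBlocks N * Vᵀ = swapBlocks N := by
    have h1 : V = swapBlocks N * W * swapBlocks N := by
      rw [mul_assoc, hB.mul_swapBlocks, ← mul_assoc, swapBlocks_mul_self, one_mul]
    rw [hV, conjMat_transpose, ← hV, h1, mul_assoc _ (swapBlocks N) (swapBlocks N),
      swapBlocks_mul_self, mul_one, mul_assoc, hB.mul_conjTranspose, mul_one]
  set G : Matrix (Fin N ⊕ Fin N) (Fin N ⊕ Fin N) ℂ :=
    Matrix.of fun a b => opExpectation (gibbsState H β) (nambu c a * nambu c b) with hG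
  have hG' : V * G * Vᵀ = occupation (fermi ε β) * swapBlocks N := by
    -- The first block has energies `-ε`, and the Fermi function satisfies `f(-ε) = 1 - f(ε)`.
    have hocc : occupation (fermi ε β) =
        Matrix.diagonal fun a => (((1 + Real.exp (β * E a))⁻¹ : ℝ) : ℂ) := by
      rw [occupation, Matrix.fromBlocks_diagonal]
      congr 1
      ext (k | k)
      · have := Real.exp_pos (β * ε k)
        simp only [Sum.elim_inl, hE, fermi, mul_neg, Real.exp_neg]
        norm_cast
        field_simp
        ring
      · simp [hE, fermi]
    ext k l
    have h1 := opTrace_gibbsState_mul (star_bdgHamiltonian c hM hΔ) (heig k)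
      (anticommutator_linear_combination hc.anticommutator_nambu V k l) β
    have h2 : opExpectation (gibbsState H β)
        ((∑ a, V k a • nambu c a) * ∑ b, V l b • nambu c b) =
        ∑ a, ∑ b, V k a * V l b * G a b := by
      rw [Finset.sum_mul_sum]
      simp only [smul_mul_smul_comm, map_sum, map_smul, smul_eq_mul]
      rfl
    rw [hocc, Matrix.diagonal_mul, mul_comm, ← hVC, ← h1, ← opExpectation_apply, h2]
    simp only [Matrix.mul_apply, Matrix.transpose_apply, Finset.sum_mul]
    rw [Finset.sum_comm]
    exact Finset.sum_congr rfl fun a _ => Finset.sum_congr rfl fun b _ => by ring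
  have hVW : Vᵀ * W = 1 := by rw [hV, conjMat_transpose, hB.conjTranspose_mul]
  -- Returns from quasi-particle correlations to those of the original field.
  have hGW : G = Wᵀ * (V * G * Vᵀ) * W := by
    calc G = (Wᵀ * V) * G * (Vᵀ * W) := by rw [hB.transpose_mul_conjMat, hVW, one_mul, mul_one]
      _ = _ := by simp only [mul_assoc]
  rw [bilinearExpectations_eq, ← hG, hGW, hG', mul_assoc, hB.mul_swapBlocks]
  simp only [mul_assoc]
  rw [← mul_assoc (swapBlocks N), swapBlocks_mul_self, one_mul]

theorem tendsto_bilinearExpectations [FiniteDimensional ℂ 𝓗] [Nontrivial 𝓗]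
    {c : Fin N → 𝓗 →L[ℂ] 𝓗} (hc : IsCAR c) (hM : M.IsHermitian) (hΔ : Δᵀ = -Δ)
    (hW : IsBogoliubovDiag M Δ W ε) {C : Finset (Fin N)} (hneg : ∀ k ∈ C, ε k < 0)
    (hpos : ∀ k, k ∉ C → 0 < ε k) :
    Filter.Tendsto (fun β => bilinearExpectations c (gibbsState (bdgHamiltonian c M Δ) β))
      Filter.atTop (nhds (projS W C)) := by
  simp only [bilinearExpectations_gibbsState hc hM hΔ hW, projS_eq]
  have hcont : Continuous fun f : Fin N → ℂ => Wᵀ * occupation f * conjMat W := by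
    unfold occupation
    fun_prop
  exact (hcont.tendsto _).comp (tendsto_pi_nhds.2 (tendsto_fermi hneg hpos))

end Thermal

/-! ### The Majorana form and the sign of its Pfaffian. -/

section Majorana

variable {N : ℕ} {𝓗 : Type*} [NormedAddCommGroup 𝓗] [InnerProductSpace ℂ 𝓗] [CompleteSpace 𝓗]

/-- The matrix that expresses the Nambu field through the Majorana operators. -/
def majoranaMatrix (N : ℕ) : Matrix (Fin N ⊕ Fin N) (Fin N ⊕ Fin N) ℂ :=
  ((Real.sqrt 2 : ℂ))⁻¹ • Matrix.fromBlocks 1 (Complex.I • 1) 1 (-Complex.I • 1)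

theorem inv_sqrt_two_mul_self : ((Real.sqrt 2 : ℂ))⁻¹ * ((Real.sqrt 2 : ℂ))⁻¹ = 1 / 2 := by
  rw [← mul_inv, ← Complex.ofReal_mul, Real.mul_self_sqrt (by norm_num)]
  norm_num

theorem det_majoranaMatrix : (majoranaMatrix N).det = (-Complex.I) ^ N := by
  have h : (-Complex.I • 1 - 1 * Complex.I • 1 : Matrix (Fin N) (Fin N) ℂ) =
      (-2 * Complex.I) • 1 := by
    ext i j; simp [Matrix.one_apply]; split_ifs <;> ring
  rw [majoranaMatrix, Matrix.det_smul, Matrix.det_fromBlocks_one₁₁, h, Matrix.det_smul,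
    Matrix.det_one, Fintype.card_sum, Fintype.card_fin, pow_add, ← mul_pow,
    inv_sqrt_two_mul_self, mul_one, ← mul_pow]
  congr 1
  ring

/-- Majorana operators are self-adjoint, so conjugating coefficients exchanges `c` and `c*`. -/
theorem conjMat_majoranaMatrix :
    conjMat (majoranaMatrix N) = swapBlocks N * majoranaMatrix N := by
  rw [swapBlocks_mul]
  ext (i | i) (j | j) <;> rcases eq_or_ne i j with rfl | h <;>
    simp [conjMat, majoranaMatrix, *]

/-- The matrix that expresses the Majorana operators through the Nambu field. -/
def majoranaMatrixInv (N : ℕ) : Matrix (Fin N ⊕ Fin N) (Fin N ⊕ Fin N) ℂ :=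
  ((Real.sqrt 2 : ℂ))⁻¹ • Matrix.fromBlocks 1 1 (-Complex.I • 1) (Complex.I • 1)

theorem majorana_eq_sum_nambu (c : Fin N → 𝓗 →L[ℂ] 𝓗) (p : Fin N ⊕ Fin N) :
    majorana c ((pairEquivSum (Fin N)).symm p) = ∑ a, majoranaMatrixInv N p a • nambu c a := by
  rcases p with i | i
  · simp [majoranaMatrixInv, majorana, pairEquivSum, nambu, Matrix.one_apply, Fintype.sum_sum_type,
      add_comm]
  · simp [majoranaMatrixInv, majorana, pairEquivSum, nambu, Matrix.one_apply, Fintype.sum_sum_type,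
      smul_sub, div_eq_inv_mul]
    abel

theorem majoranaMatrix_mul_inv : majoranaMatrix N * majoranaMatrixInv N = 1 := by
  simp only [majoranaMatrix, majoranaMatrixInv, smul_mul_assoc, mul_smul_comm, smul_smul,
    inv_sqrt_two_mul_self, Matrix.fromBlocks_multiply, mul_one]
  ext (i | i) (j | j) <;> simp [Matrix.one_apply] <;> split_ifs <;> norm_num

theorem majoranaMatrixInv_mul_swapBlocks_mul_transpose :
    majoranaMatrixInv N * swapBlocks N * (majoranaMatrixInv N)ᵀ = 1 := by
  simp only [majoranaMatrixInv, swapBlocks, Matrix.transpose_smul, Matrix.fromBlocks_transpose,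
    smul_mul_assoc, mul_smul_comm, smul_smul, inv_sqrt_two_mul_self, Matrix.fromBlocks_multiply,
    Matrix.transpose_one, mul_zero, mul_one, zero_add, add_zero]
  ext (i | i) (j | j) <;> simp [Matrix.one_apply] <;> split_ifs <;> norm_num

theorem majorana_anticommutator {c : Fin N → 𝓗 →L[ℂ] 𝓗} (hc : IsCAR c)
    (p q : Fin N ⊕ Fin N) :
    majorana c ((pairEquivSum (Fin N)).symm p) * majorana c ((pairEquivSum (Fin N)).symm q) +
      majorana c ((pairEquivSum (Fin N)).symm q) * majorana c ((pairEquivSum (Fin N)).symm p) =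
      (1 : Matrix (Fin N ⊕ Fin N) (Fin N ⊕ Fin N) ℂ) p q • 1 := by
  rw [majorana_eq_sum_nambu, majorana_eq_sum_nambu,
    anticommutator_linear_combination hc.anticommutator_nambu,
    majoranaMatrixInv_mul_swapBlocks_mul_transpose]

theorem nambu_eq_sum_majorana (c : Fin N → 𝓗 →L[ℂ] 𝓗) (a : Fin N ⊕ Fin N) :
    nambu c a =
      ∑ p, majoranaMatrix N a p • majorana c ((pairEquivSum (Fin N)).symm p) := by
  simp only [majorana_eq_sum_nambu, Finset.smul_sum, smul_smul]
  rw [Finset.sum_comm]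
  simp only [← Finset.sum_smul, ← Matrix.mul_apply, majoranaMatrix_mul_inv, Matrix.one_apply,
    ite_smul, one_smul, zero_smul, Finset.sum_ite_eq, Finset.mem_univ, if_true]

/-- The complex matrix `-i Uᵀ Q U` of the Majorana representation, on the labels of the blocks. -/
def majoranaForm (M Δ : Matrix (Fin N) (Fin N) ℂ) : Matrix (Fin N ⊕ Fin N) (Fin N ⊕ Fin N) ℂ :=
  -Complex.I • ((majoranaMatrix N)ᵀ * (bdgMatrix M Δ * swapBlocks N) * majoranaMatrix N)

variable {M Δ : Matrix (Fin N) (Fin N) ℂ}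

theorem majoranaForm_transpose (hM : M.IsHermitian) (hΔ : Δᵀ = -Δ) :
    (majoranaForm M Δ)ᵀ = -majoranaForm M Δ := by
  rw [majoranaForm, Matrix.transpose_smul, Matrix.transpose_mul, Matrix.transpose_mul,
    bdgMatrix_mul_swapBlocks_transpose hM hΔ, Matrix.transpose_transpose, Matrix.neg_mul,
    Matrix.mul_neg, smul_neg, mul_assoc, mul_assoc]
  simp only [mul_assoc]

/-- The bilinear form `Q` of the Hamiltonian satisfies `C (conj Q) C = -Q`; this sign cancels the
one from conjugating `-i`, so the form is real. -/
theorem conjMat_majoranaForm : conjMat (majoranaForm M Δ) = majoranaForm M Δ := by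
  have h1 : swapBlocks N * conjMat (bdgMatrix M Δ * swapBlocks N) * swapBlocks N =
      -(bdgMatrix M Δ * swapBlocks N) := by
    rw [swapBlocks_mul, mul_swapBlocks, bdgMatrix_mul_swapBlocks]
    ext (i | i) (j | j) <;> simp [conjMat]
  have h2 : ∀ X : Matrix (Fin N ⊕ Fin N) (Fin N ⊕ Fin N) ℂ,
      conjMat (-Complex.I • X) = Complex.I • conjMat X := by
    intro X; ext; simp [conjMat]
  have h3 : conjMat (majoranaMatrix N)ᵀ = (majoranaMatrix N)ᵀ * swapBlocks N := by
    rw [← swapBlocks_transpose, ← Matrix.transpose_mul, ← conjMat_majoranaMatrix]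
    rfl
  rw [majoranaForm, h2, conjMat_mul, conjMat_mul, conjMat_majoranaMatrix, h3,
    show ∀ U C Q : Matrix (Fin N ⊕ Fin N) (Fin N ⊕ Fin N) ℂ,
      Uᵀ * C * Q * (C * U) = Uᵀ * (C * Q * C) * U from fun _ _ _ => by simp only [mul_assoc], h1,
    Matrix.mul_neg, Matrix.neg_mul, smul_neg, neg_smul]

theorem bdgHamiltonian_eq_majoranaForm (c : Fin N → 𝓗 →L[ℂ] 𝓗) (hM : M.IsHermitian) :
    bdgHamiltonian c M Δ = (Complex.I / 2) • ∑ p, ∑ q, majoranaForm M Δ p q •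
      (majorana c ((pairEquivSum (Fin N)).symm p) *
        majorana c ((pairEquivSum (Fin N)).symm q)) := by
  rw [bdgHamiltonian_eq c Δ hM]
  simp only [nambu_eq_sum_majorana]
  rw [quadratic_form_linear_combination]
  simp only [majoranaForm, Matrix.smul_apply, smul_assoc, ← Finset.smul_sum]
  rw [smul_smul]
  congr 1
  linear_combination (1 / 2 : ℂ) * Complex.I_mul_I

/-- The real skew-symmetric matrix of the Majorana representation. -/
def realMajoranaForm (M Δ : Matrix (Fin N) (Fin N) ℂ) :
    Matrix (Fin N × Fin 2) (Fin N × Fin 2) ℝ :=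
  Matrix.of fun p q => (majoranaForm M Δ (pairEquivSum (Fin N) p) (pairEquivSum (Fin N) q)).re

theorem ofReal_realMajoranaForm (p q : Fin N × Fin 2) :
    (realMajoranaForm M Δ p q : ℂ) =
      majoranaForm M Δ (pairEquivSum (Fin N) p) (pairEquivSum (Fin N) q) :=
  Complex.conj_eq_iff_re.1
    (congrFun₂ (conjMat_majoranaForm (M := M) (Δ := Δ)) (pairEquivSum _ p) (pairEquivSum _ q))

theorem isMajoranaForm_realMajoranaForm (c : Fin N → 𝓗 →L[ℂ] 𝓗) (hM : M.IsHermitian)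
    (hΔ : Δᵀ = -Δ) : IsMajoranaForm c M Δ (realMajoranaForm M Δ) := by
  refine ⟨?_, ?_⟩
  · ext p q
    exact congrArg Complex.re
      (congrFun₂ (majoranaForm_transpose hM hΔ) (pairEquivSum _ p) (pairEquivSum _ q))
  · rw [bdgHamiltonian_eq_majoranaForm c hM]
    simp only [ofReal_realMajoranaForm]
    rw [← (pairEquivSum (Fin N)).sum_comp]
    congr 1
    refine Finset.sum_congr rfl fun p _ => ?_
    rw [← (pairEquivSum (Fin N)).sum_comp]
    simp only [Equiv.symm_apply_apply]

theorem IsMajoranaForm.eq [Nontrivial 𝓗] {c : Fin N → 𝓗 →L[ℂ] 𝓗} (hc : IsCAR c)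
    {A A' : Matrix (Fin N × Fin 2) (Fin N × Fin 2) ℝ} (hA : IsMajoranaForm c M Δ A)
    (hA' : IsMajoranaForm c M Δ A') : A = A' := by
  have hcar : ∀ p q, majorana c p * majorana c q + majorana c q * majorana c p =
      (1 : Matrix (Fin N × Fin 2) (Fin N × Fin 2) ℂ) p q • 1 := by
    intro p q
    have h := majorana_anticommutator hc (pairEquivSum _ p) (pairEquivSum _ q)
    simpa only [Equiv.symm_apply_apply, Matrix.one_apply, EmbeddingLike.apply_eq_iff_eq] using h
  have hskew : ∀ {B : Matrix (Fin N × Fin 2) (Fin N × Fin 2) ℝ}, Bᵀ = -B →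
      (B.map ((↑) : ℝ → ℂ))ᵀ = -B.map ((↑) : ℝ → ℂ) := by
    intro B hB
    ext p q
    simpa using congrArg ((↑) : ℝ → ℂ) (congrFun₂ hB p q)
  have h := hA.2.symm.trans hA'.2
  have hI : Complex.I / 2 ≠ 0 := by simp
  have h1 := quadratic_form_injective hcar (hskew hA.1) (hskew hA'.1)
    (smul_right_injective _ hI h)
  ext p q
  exact Complex.ofReal_injective (congrFun₂ h1 p q)

variable {W : Matrix (Fin N ⊕ Fin N) (Fin N ⊕ Fin N) ℂ} {ε : Fin N → ℝ}

/-- Two congruences, by the Majorana change of basis and by `conj W`, reduce the form to `2 × 2`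
blocks with entries `-ε k`. -/
theorem pfaffian_realMajoranaForm (hW : IsBogoliubovDiag M Δ W ε) :
    ((pfaffian (realMajoranaForm M Δ) : ℝ) : ℂ) = W.det * ((∏ k, ε k : ℝ) : ℂ) := by
  have hB := hW.isBogoliubov
  have h1 : ((pfaffian (realMajoranaForm M Δ) : ℝ) : ℂ) =
      pfaffian ((majoranaForm M Δ).submatrix (pairEquivSum (Fin N)) (pairEquivSum (Fin N))) := by
    refine (pfaffian_map Complex.ofRealHom (realMajoranaForm M Δ)).symm.trans ?_
    congr 1
    ext p q
    exact ofReal_realMajoranaForm p q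
  have h2 : bdgMatrix M Δ * swapBlocks N = (conjMat W)ᵀ *
      Matrix.fromBlocks 0 (Matrix.diagonal fun k => -(ε k : ℂ))
        (-Matrix.diagonal fun k => -(ε k : ℂ)) 0 * conjMat W := by
    rw [hW.diag, mul_assoc _ W, hB.mul_swapBlocks, conjMat_transpose, ← mul_assoc,
      mul_assoc Wᴴ]
    congr 2
    rw [swapBlocks, Matrix.fromBlocks_multiply]
    simp only [mul_zero, mul_one, zero_add, add_zero, Matrix.diagonal_neg, neg_neg]
  rw [h1, majoranaForm, Matrix.submatrix_smul, Pi.smul_apply, Pi.smul_apply, pfaffian_smul,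
    pfaffian_submatrix_congruence, det_majoranaMatrix, h2, pfaffian_submatrix_congruence,
    pfaffian_fromBlocks_diagonal, hB.det_conjMat, Fintype.card_fin]
  simp only [Finset.prod_neg, Finset.card_univ, Fintype.card_fin]
  -- The three factors come from the scalar `-i`, the determinant of the Majorana change of basis,
  -- and the signs of the entries `-ε k`.
  have h3 : (-Complex.I) ^ N * (-Complex.I) ^ N * (-1) ^ N = 1 := by
    rw [← mul_pow, ← mul_pow]; simp
  push_cast
  linear_combination (W.det * ∏ k, (ε k : ℂ)) * h3

theorem Real.sign_mul (a b : ℝ) : Real.sign (a * b) = Real.sign a * Real.sign b := by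
  rcases lt_trichotomy a 0 with ha | rfl | ha <;> rcases lt_trichotomy b 0 with hb | rfl | hb <;>
    simp [Real.sign_of_neg, Real.sign_of_pos, mul_pos_of_neg_of_neg, mul_neg_of_neg_of_pos,
      mul_neg_of_pos_of_neg, *]

theorem Real.sign_prod {ι : Type*} (s : Finset ι) (f : ι → ℝ) :
    Real.sign (∏ k ∈ s, f k) = ∏ k ∈ s, Real.sign (f k) := by
  classical
  induction s using Finset.induction_on with
  | empty => simp
  | insert k s hk ih => rw [Finset.prod_insert hk, Finset.prod_insert hk, Real.sign_mul, ih]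

/-- The sign of the Majorana Pfaffian is `det W`, up to the parity of the set of negative
quasi-particle energies. -/
theorem IsMajoranaForm.sign_pfaffian [Nontrivial 𝓗] {c : Fin N → 𝓗 →L[ℂ] 𝓗} (hc : IsCAR c)
    (hM : M.IsHermitian) (hΔ : Δᵀ = -Δ) (hW : IsBogoliubovDiag M Δ W ε)
    {A : Matrix (Fin N × Fin 2) (Fin N × Fin 2) ℝ} (hA : IsMajoranaForm c M Δ A)
    {C : Finset (Fin N)} (hneg : ∀ k ∈ C, ε k < 0) (hpos : ∀ k, k ∉ C → 0 < ε k) :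
    (-1) ^ C.card * W.det = ((Real.sign (pfaffian A) : ℝ) : ℂ) := by
  rw [hA.eq hc (isMajoranaForm_realMajoranaForm c hM hΔ)]
  have hpf := pfaffian_realMajoranaForm hW
  have hprod : Real.sign (∏ k, ε k) = (-1) ^ C.card := by
    rw [Real.sign_prod, ← Finset.prod_const, ← Finset.prod_subset (Finset.subset_univ C)]
    · exact Finset.prod_congr rfl fun k hk => Real.sign_of_neg (hneg k hk)
    · exact fun k _ hk => Real.sign_of_pos (hpos k hk)
  rcases hW.isBogoliubov.det_eq with h | h <;> rw [h] at hpf ⊢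
  · have : pfaffian (realMajoranaForm M Δ) = ∏ k, ε k := by exact_mod_cast hpf.trans (one_mul _)
    rw [this, hprod]
    push_cast
    ring
  · have : pfaffian (realMajoranaForm M Δ) = -∏ k, ε k := by
      exact_mod_cast hpf.trans (neg_one_mul _)
    rw [this, Real.sign_neg, hprod]
    push_cast
    ring

end Majorana

/-! ### Parity of the thermal and projective processes, and the final assembly. -/

theorem isPfPP_thermal_expectedParity {N : ℕ} {𝓗 : Type*} [NormedAddCommGroup 𝓗]
    [InnerProductSpace ℂ 𝓗] [CompleteSpace 𝓗] [FiniteDimensional ℂ 𝓗] [Nontrivial 𝓗]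
    {c : Fin N → 𝓗 →L[ℂ] 𝓗} (hc : IsCAR c) {M Δ : Matrix (Fin N) (Fin N) ℂ}
    (hM : M.IsHermitian) (hΔ : Δᵀ = -Δ) {W : Matrix (Fin N ⊕ Fin N) (Fin N ⊕ Fin N) ℂ}
    {ε : Fin N → ℝ} (hW : IsBogoliubovDiag M Δ W ε) {β : ℝ} {μ : PMF (Finset (Fin N))}
    (hμ : IsPfPP (thermalKernel c M Δ β) μ) :
    (expectedParity μ : ℂ) = W.det * ((∏ k, Real.tanh (β * ε k / 2) : ℝ) : ℂ) := by
  rw [thermalKernel, bilinearExpectations_gibbsState hc hM hΔ hW] at hμ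
  rw [hμ.expectedParity_eq hW.isBogoliubov]
  simp only [one_sub_two_mul_fermi, Complex.ofReal_prod]

theorem isPfPP_projS_expectedParity {N : ℕ} {W : Matrix (Fin N ⊕ Fin N) (Fin N ⊕ Fin N) ℂ}
    (hW : IsBogoliubov W) {C : Finset (Fin N)} {μ : PMF (Finset (Fin N))}
    (hμ : IsPfPP (kernelOf (projS W C)) μ) :
    (expectedParity μ : ℂ) = (-1) ^ C.card * W.det ∧
      ∀ Y ∈ μ.support, (-1 : ℝ) ^ Y.card = expectedParity μ := by
  have h : (expectedParity μ : ℂ) = (-1) ^ C.card * W.det := by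
    rw [projS_eq] at hμ
    rw [hμ.expectedParity_eq hW, prod_one_sub_two_mul_ite, mul_comm]
  refine ⟨h, fun Y hY => neg_one_pow_card_eq_expectedParity ?_ hY⟩
  have h' : (expectedParity μ : ℂ) = 1 ∨ (expectedParity μ : ℂ) = -1 := by
    rw [h]
    rcases neg_one_pow_eq_or ℂ C.card with h1 | h1 <;> rcases hW.det_eq with h2 | h2 <;>
      rw [h1, h2] <;> norm_num
  exact_mod_cast h'

theorem mainTheorem1 {N : ℕ} {𝓗 : Type*} [NormedAddCommGroup 𝓗] [InnerProductSpace ℂ 𝓗]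
    [CompleteSpace 𝓗] [FiniteDimensional ℂ 𝓗] [Nontrivial 𝓗]
    (c : Fin N → 𝓗 →L[ℂ] 𝓗) (hc : IsCAR c)
    (M Δ : Matrix (Fin N) (Fin N) ℂ) (hM : M.IsHermitian) (hΔ : Δᵀ = -Δ)
    (W : Matrix (Fin N ⊕ Fin N) (Fin N ⊕ Fin N) ℂ) (ε : Fin N → ℝ)
    (hW : IsBogoliubovDiag M Δ W ε) :
    -- expected parity at inverse temperature `β`
    (∀ β : ℝ, 0 < β → ∀ μ : PMF (Finset (Fin N)), IsPfPP (thermalKernel c M Δ β) μ →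
      (expectedParity μ : ℂ) = W.det * ((∏ k, Real.tanh (β * ε k / 2) : ℝ) : ℂ)) ∧
    -- the Majorana quadratic form, and the determinant of `W` for positive energies
    (∃! A : Matrix (Fin N × Fin 2) (Fin N × Fin 2) ℝ, IsMajoranaForm c M Δ A) ∧
    (∀ A : Matrix (Fin N × Fin 2) (Fin N × Fin 2) ℝ, IsMajoranaForm c M Δ A →
      (∀ k, 0 < ε k) →
        W.det = ((Real.sign (pfaffian A) : ℝ) : ℂ) ∧
        ∀ β : ℝ, 0 < β → ∀ μ : PMF (Finset (Fin N)), IsPfPP (thermalKernel c M Δ β) μ →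
          expectedParity μ = Real.sign (pfaffian A) * ∏ k, Real.tanh (β * ε k / 2)) ∧
    -- the projective Pfaffian point processes have almost surely fixed parity
    (W.det = 1 ∨ W.det = -1) ∧
    (∀ C : Finset (Fin N),
      (projS W C).IsHermitian ∧ projS W C * projS W C = projS W C ∧
      swapBlocks N * conjMat (projS W C) * swapBlocks N = 1 - projS W C ∧
      ∀ μ : PMF (Finset (Fin N)), IsPfPP (kernelOf (projS W C)) μ →
        (expectedParity μ : ℂ) = (-1) ^ C.card * W.det ∧
        ∀ Y ∈ μ.support, (-1 : ℂ) ^ Y.card = (-1) ^ C.card * W.det) ∧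
    -- the zero-temperature limit, with energies negative on `C` and positive off `C`
    (∀ C : Finset (Fin N), (∀ k ∈ C, ε k < 0) → (∀ k, k ∉ C → 0 < ε k) →
      (∀ T : Finset (Fin N),
        Filter.Tendsto (fun β : ℝ => pfCorrelation (thermalKernel c M Δ β) T) Filter.atTop
          (nhds (pfCorrelation (kernelOf (projS W C)) T))) ∧
      (∀ A : Matrix (Fin N × Fin 2) (Fin N × Fin 2) ℝ, IsMajoranaForm c M Δ A →
        (-1) ^ C.card * W.det = ((Real.sign (pfaffian A) : ℝ) : ℂ)) ∧
      ∀ μ : ℝ → PMF (Finset (Fin N)), (∀ β, 0 < β → IsPfPP (thermalKernel c M Δ β) (μ β)) →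
        ∃ ν : PMF (Finset (Fin N)), IsPfPP (kernelOf (projS W C)) ν ∧
          (∀ Y, Filter.Tendsto (fun β => μ β Y) Filter.atTop (nhds (ν Y))) ∧
          Filter.Tendsto (fun β => expectedParity (μ β)) Filter.atTop
            (nhds (expectedParity ν)) ∧
          ∀ A : Matrix (Fin N × Fin 2) (Fin N × Fin 2) ℝ, IsMajoranaForm c M Δ A →
            expectedParity ν = Real.sign (pfaffian A) ∧
            ∀ Y ∈ ν.support, (-1 : ℝ) ^ Y.card = Real.sign (pfaffian A)) := by

  have hB := hW.isBogoliubov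
  have hT : ∀ C : Finset (Fin N), (∀ k ∈ C, ε k < 0) → (∀ k, k ∉ C → 0 < ε k) →
      ∀ T : Finset (Fin N),
        Filter.Tendsto (fun β : ℝ => pfCorrelation (thermalKernel c M Δ β) T) Filter.atTop
          (nhds (pfCorrelation (kernelOf (projS W C)) T)) := fun C hneg hpos T =>
    ((continuous_pfCorrelation_kernelOf T).tendsto _).comp
      (tendsto_bilinearExpectations hc hM hΔ hW hneg hpos)
  refine ⟨fun β _ μ hμ => isPfPP_thermal_expectedParity hc hM hΔ hW hμ,
    ⟨_, isMajoranaForm_realMajoranaForm c hM hΔ, fun A hA =>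
      hA.eq hc (isMajoranaForm_realMajoranaForm c hM hΔ)⟩, ?_, hB.det_eq, ?_, ?_⟩
  · intro A hA hpos
    have hdet : W.det = ((Real.sign (pfaffian A) : ℝ) : ℂ) := by
      simpa using hA.sign_pfaffian hc hM hΔ hW (C := ∅) (by simp) fun k _ => hpos k
    refine ⟨hdet, fun β _ μ hμ => ?_⟩
    have h := isPfPP_thermal_expectedParity hc hM hΔ hW hμ
    rw [hdet] at h
    exact_mod_cast h
  · intro C
    refine ⟨projS_isHermitian C, projS_mul_self hB C, swapBlocks_mul_conjMat_projS hB C,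
      fun μ hμ => ?_⟩
    obtain ⟨h1, h2⟩ := isPfPP_projS_expectedParity hB hμ
    refine ⟨h1, fun Y hY => ?_⟩
    rw [← h1, ← h2 Y hY]
    push_cast
    rfl
  · intro C hneg hpos
    refine ⟨hT C hneg hpos, fun A hA => hA.sign_pfaffian hc hM hΔ hW hneg hpos, ?_⟩
    intro μ hμ
    have hlim : ∀ T, Filter.Tendsto (fun β => ((μ β).toOuterMeasure {Y | T ⊆ Y}).toReal)
        Filter.atTop (nhds (pfCorrelation (kernelOf (projS W C)) T).re) := by
      intro T
      refine ((Complex.continuous_re.tendsto _).comp (hT C hneg hpos T)).congr' ?_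
      filter_upwards [Filter.eventually_gt_atTop 0] with β hβ
      rw [Function.comp_apply, ← (hμ β hβ).2 T, Complex.ofReal_re]
    obtain ⟨ν, hν, hνT⟩ := exists_pmf_tendsto_of_tendsto_superset μ _ hlim
    have hνP : IsPfPP (kernelOf (projS W C)) ν := by
      refine ⟨kernelOf_projS_transpose hB C, fun T => ?_⟩
      -- The limiting correlation is a priori complex; it equals its real part because it is a limit
      -- of probabilities, known to be correlations only for `β > 0`.
      refine tendsto_nhds_unique ?_ (hT C hneg hpos T)
      rw [hνT]
      refine ((Complex.continuous_ofReal.tendsto _).comp (hlim T)).congr' ?_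
      filter_upwards [Filter.eventually_gt_atTop 0] with β hβ
      exact (hμ β hβ).2 T
    refine ⟨ν, hνP, hν, tendsto_expectedParity hν, fun A hA => ?_⟩
    obtain ⟨h1, h2⟩ := isPfPP_projS_expectedParity hB hνP
    have h3 : expectedParity ν = Real.sign (pfaffian A) := by
      rw [hA.sign_pfaffian hc hM hΔ hW hneg hpos] at h1
      exact_mod_cast h1
    exact ⟨h3, fun Y hY => (h2 Y hY).trans h3⟩

end
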